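/- For $i=1,2$ let $e_i,e_i'\in\mathbb C$ be linearly independent over $\mathbb R$, let $E_i'=\mathbb C/(\mathbb Z e_i\oplus\mathbb Z e_i')$ with origin $o_i$, and let $p_i:E_1'\times E_2'\to E_i'$ be the projections. Let $G=(\mathbb Z/2\mathbb Z)^2$, generated by $g_1,g_2$, act on $E_1'$ by $g_1(z)=z+\frac{e_1}{2}$, $g_2(z)=-z$, on $E_2'$ by $g_1(z)=-z$, $g_2(z)=z+\frac{e_2}{2}$, and diagonally on $E_1'\times E_2'$, so that $g_1(z_1,z_2)=(z_1+\frac{e_1}{2},-z_2)$ and $g_2(z_1,z_2)=(-z_1,z_2+\frac{e_2}{2})$. The divisors $2[o_i]+2[\frac{e_i}{2}]$ are $G$-invariant, so $G$ acts, by pullback of meromorphic functions, on the spaces $$H_i:=H^0\big(E_i',\mathcal O_{E_i'}(2[o_i]+2[\tfrac{e_i}{2}])\big),\qquad H:=H^0\big(E_1'\times E_2',\,p_1^*\mathcal O_{E_1'}(2[o_1]+2[\tfrac{e_1}{2}])\otimes p_2^*\mathcal O_{E_2'}(2[o_2]+2[\tfrac{e_2}{2}])\big).$$ For signs $\varepsilon_1,\varepsilon_2\in\{+,-\}$,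 let $V_i^{\varepsilon_1\varepsilon_2}\subseteq H_i$ and $H^{\varepsilon_1\varepsilon_2}\subseteq H$ be the subspaces on which $g_1$ acts as $\varepsilon_1 1$ and $g_2$ acts as $\varepsilon_2 1$; thus $H^{++}=H^G$. Then, under the canonical map $H_1\otimes H_2\to H$, $s\otimes t\mapsto p_1^*s\otimes p_2^*t$: 1) $H^{++}=H^G=(V_1^{++}\otimes V_2^{++})\oplus(V_1^{--}\otimes V_2^{--})\cong\mathbb C^5$; 2) $H^{--}=(V_1^{++}\otimes V_2^{--})\oplus(V_1^{--}\otimes V_2^{++})\oplus(V_1^{-+}\otimes V_2^{+-})\cong\mathbb C^5$. (The equalities mean that the canonical map is injective on the displayed direct sum and has the displayed eigenspace as its image.) -/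

import Mathlib

open scoped TensorProduct Topology

noncomputable section

namespace KeumNaie

/-! ### Complex tori, divisors and their invertible sheaves -/

/-- The elliptic curve `ℂ / (ℤ e ⊕ ℤ e')` of a pair of periods `e = P.ω₁`, `e' = P.ω₂`
(linearly independent over `ℝ`). -/
abbrev Torus (P : PeriodPair) : Type := ℂ ⧸ P.lattice

/-- The projection `ℂ → ℂ / Λ`. A function on (an open subset of) the torus is holomorphic iff its
composition with this local homeomorphism is. -/
abbrev proj (P : PeriodPair) (z : ℂ) : Torus P := P.lattice.mkQ z

/-- Divisors on the torus. -/
abbrev Divisor (P : PeriodPair) : Type := Torus P →₀ ℤ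

/-- The complement of the support of a divisor. -/
abbrev Off {P : PeriodPair} (D : Divisor P) : Type := {x : Torus P // D x = 0}

/-- `s` is a section of the invertible sheaf `𝒪(D)` in a neighbourhood of the image of `z`:
a meromorphic function, holomorphic off the support of `D`, with `div s + D ≥ 0` near that point. -/
def IsSectionAt {P : PeriodPair} (D : Divisor P) (s : Off D → ℂ) (z : ℂ) : Prop :=
  ∃ h : ℂ → ℂ, AnalyticAt ℂ h z ∧
    ∀ᶠ w in 𝓝 z, ∀ hw : D (proj P w) = 0,
      s ⟨proj P w, hw⟩ = (w - z) ^ (-D (proj P z)) * h w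

/-- `H⁰(E, 𝒪_E(D))`. -/
def H0 {P : PeriodPair} (D : Divisor P) : Submodule ℂ (Off D → ℂ) where
  carrier := {s | ∀ z, IsSectionAt D s z}
  zero_mem' := fun z => ⟨0, analyticAt_const, by simp⟩
  add_mem' := by
    intro s t hs ht z
    obtain ⟨h, hh, hs⟩ := hs z
    obtain ⟨k, hk, ht⟩ := ht z
    refine ⟨h + k, hh.add hk, ?_⟩
    filter_upwards [hs, ht] with w hs ht hw
    simp only [Pi.add_apply, hs hw, ht hw, mul_add]
  smul_mem' := by
    intro c s hs z
    obtain ⟨h, hh, hs⟩ := hs z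
    refine ⟨fun w => c * h w, analyticAt_const.mul hh, ?_⟩
    filter_upwards [hs] with w hs hw
    simp only [Pi.smul_apply, hs hw, smul_eq_mul]
    ring

/-- `F` is a section of `p₁^* 𝒪(D₁) ⊗ p₂^* 𝒪(D₂)` in a neighbourhood of the image of `z`.
This sheaf is, inside the sheaf of meromorphic functions of the product, the module over the
holomorphic functions generated by the products `p₁^* s * p₂^* t` of local sections
`s` of `𝒪(D₁)` and `t` of `𝒪(D₂)`. -/
def IsBoxSectionAt {P Q : PeriodPair} (D₁ : Divisor P) (D₂ : Divisor Q)
    (F : Off D₁ × Off D₂ → ℂ) (z : ℂ × ℂ) : Prop :=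
  ∃ (n : ℕ) (h : Fin n → ℂ × ℂ → ℂ) (s : Fin n → Off D₁ → ℂ) (t : Fin n → Off D₂ → ℂ),
    (∀ k, AnalyticAt ℂ (h k) z) ∧ (∀ k, IsSectionAt D₁ (s k) z.1) ∧
    (∀ k, IsSectionAt D₂ (t k) z.2) ∧
    ∀ᶠ w in 𝓝 z, ∀ (hw₁ : D₁ (proj P w.1) = 0) (hw₂ : D₂ (proj Q w.2) = 0),
      F (⟨proj P w.1, hw₁⟩, ⟨proj Q w.2, hw₂⟩) =
        ∑ k, h k w * (s k ⟨proj P w.1, hw₁⟩ * t k ⟨proj Q w.2, hw₂⟩)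

/-- `H⁰(E₁ × E₂, p₁^* 𝒪(D₁) ⊗ p₂^* 𝒪(D₂))`. -/
def boxH0 {P Q : PeriodPair} (D₁ : Divisor P) (D₂ : Divisor Q) :
    Submodule ℂ (Off D₁ × Off D₂ → ℂ) where
  carrier := {F | ∀ z, IsBoxSectionAt D₁ D₂ F z}
  zero_mem' := fun z => ⟨0, Fin.elim0, Fin.elim0, Fin.elim0, fun k => k.elim0,
    fun k => k.elim0, fun k => k.elim0, by simp⟩
  add_mem' := by
    intro F F' hF hF' z
    obtain ⟨n, h, s, t, hh, hs, ht, e⟩ := hF z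
    obtain ⟨n', h', s', t', hh', hs', ht', e'⟩ := hF' z
    refine ⟨n + n', Fin.append h h', Fin.append s s', Fin.append t t', ?_, ?_, ?_, ?_⟩
    · intro k
      refine Fin.addCases (fun i => ?_) (fun i => ?_) k
      · simpa using hh i
      · simpa using hh' i
    · intro k
      refine Fin.addCases (fun i => ?_) (fun i => ?_) k
      · simpa using hs i
      · simpa using hs' i
    · intro k
      refine Fin.addCases (fun i => ?_) (fun i => ?_) k
      · simpa using ht i
      · simpa using ht' i
    · filter_upwards [e, e'] with w e e' hw₁ hw₂
      simp only [Pi.add_apply, e hw₁ hw₂, e' hw₁ hw₂, Fin.sum_univ_add, Fin.append_left,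
        Fin.append_right]
  smul_mem' := by
    intro c F hF z
    obtain ⟨n, h, s, t, hh, hs, ht, e⟩ := hF z
    refine ⟨n, fun k w => c * h k w, s, t, fun k => analyticAt_const.mul (hh k), hs, ht, ?_⟩
    filter_upwards [e] with w e hw₁ hw₂
    simp only [Pi.smul_apply, e hw₁ hw₂, smul_eq_mul, Finset.mul_sum, mul_assoc]

/-! ### The action of `G = (ℤ/2)²` on a torus -/

/-- The map `x ↦ (-1)^b x + a η`. -/
def act {A : Type*} [AddCommGroup A] (η : A) (g : ZMod 2 × ZMod 2) (x : A) : A :=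
  (-1 : ℤ) ^ g.2.val • x + g.1.val • η

lemma act_zero {A : Type*} [AddCommGroup A] (η x : A) : act η 0 x = x := by
  simp [act]

lemma act_add {A : Type*} [AddCommGroup A] (η : A) (hη : η + η = 0) (g g' : ZMod 2 × ZMod 2)
    (x : A) : act η (g + g') x = act η g' (act η g x) := by
  have h2 : -η = η := neg_eq_of_add_eq_zero_left hη
  have v0 : (0 : ZMod 2).val = 0 := rfl
  have v1 : (1 : ZMod 2).val = 1 := rfl
  have v2 : (1 + 1 : ZMod 2).val = 0 := rfl
  obtain ⟨a, b⟩ := g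
  obtain ⟨a', b'⟩ := g'
  have key : ∀ c : ZMod 2, c = 0 ∨ c = 1 := by decide
  rcases key a with rfl | rfl <;> rcases key b with rfl | rfl <;>
    rcases key a' with rfl | rfl <;> rcases key b' with rfl | rfl <;>
    simp [act, v0, v1, v2, h2, hη, add_assoc]

/-- The 2-torsion point `e/2`. -/
def half (P : PeriodPair) : Torus P := proj P (P.ω₁ / 2)

lemma half_add_half (P : PeriodPair) : half P + half P = 0 := by
  rw [half, ← map_add, add_halves]
  exact (Submodule.Quotient.mk_eq_zero _).2 P.ω₁_mem_lattice

lemma proj_act (P : PeriodPair) (g : ZMod 2 × ZMod 2) (z : ℂ) :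
    proj P (act (P.ω₁ / 2) g z) = act (half P) g (proj P z) := by
  simp only [act, half, proj, map_add, map_zsmul, map_nsmul]

/-- The divisor `2[o] + 2[e/2]`. -/
def div4 (P : PeriodPair) : Divisor P := Finsupp.single 0 2 + Finsupp.single (half P) 2

lemma div4_act (P : PeriodPair) (g : ZMod 2 × ZMod 2) (x : Torus P) :
    div4 P (act (half P) g x) = div4 P x := by
  classical
  have h2 : -half P = half P := neg_eq_of_add_eq_zero_left (half_add_half P)
  have v0 : (0 : ZMod 2).val = 0 := rfl
  have v1 : (1 : ZMod 2).val = 1 := rfl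
  have neg : ∀ y, div4 P (-y) = div4 P y := by
    intro y
    have e : half P = -y ↔ half P = y := by rw [← neg_eq_iff_eq_neg, h2]
    simp [div4, Finsupp.single_apply, e, eq_comm (a := (0 : Torus P))]
  have tr : ∀ y, div4 P (y + half P) = div4 P y := by
    intro y
    have e : (0 = y + half P) ↔ half P = y := by
      rw [eq_comm, add_eq_zero_iff_eq_neg, h2, eq_comm]
    have e' : (half P = y + half P) ↔ 0 = y := by
      rw [right_eq_add, eq_comm]
    simp [div4, Finsupp.single_apply, e, e', add_comm]
  obtain ⟨a, b⟩ := g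
  have key : ∀ c : ZMod 2, c = 0 ∨ c = 1 := by decide
  rcases key a with rfl | rfl <;> rcases key b with rfl | rfl <;>
    simp [act, v0, v1, neg, tr]

/-- The action on the complement of the support of `2[o] + 2[e/2]`. -/
def offAct (P : PeriodPair) (g : ZMod 2 × ZMod 2) (x : Off (div4 P)) : Off (div4 P) :=
  ⟨act (half P) g x.1, by rw [div4_act]; exact x.2⟩

lemma offAct_zero (P : PeriodPair) (x : Off (div4 P)) : offAct P 0 x = x :=
  Subtype.ext (act_zero _ _)

lemma offAct_add (P : PeriodPair) (g g' : ZMod 2 × ZMod 2) (x : Off (div4 P)) :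
    offAct P (g + g') x = offAct P g' (offAct P g x) :=
  Subtype.ext (act_add _ (half_add_half P) _ _ _)

lemma act_sub {A : Type*} [AddCommGroup A] (η : A) (g : ZMod 2 × ZMod 2) (x y : A) :
    act η g x - act η g y = (-1 : ℤ) ^ g.2.val • (x - y) := by
  simp only [act, smul_sub]
  abel

lemma analyticAt_act (η : ℂ) (g : ZMod 2 × ZMod 2) (z : ℂ) : AnalyticAt ℂ (act η g) z := by
  have : act η g = fun x : ℂ => ((-1 : ℤ) ^ g.2.val : ℤ) * x + g.1.val • η := by
    funext x; simp [act]
  rw [this]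
  fun_prop

/-- Pullback by an element of `G` preserves local sections of `𝒪(2[o] + 2[e/2])`. -/
lemma isSectionAt_comp (P : PeriodPair) (g : ZMod 2 × ZMod 2) (s : Off (div4 P) → ℂ) (z : ℂ)
    (hs : IsSectionAt (div4 P) s (act (P.ω₁ / 2) g z)) :
    IsSectionAt (div4 P) (fun x => s (offAct P g x)) z := by
  obtain ⟨h, hh, hs⟩ := hs
  refine ⟨fun w => (((-1 : ℤ) ^ g.2.val : ℤ) : ℂ) ^ (-div4 P (proj P z)) *
    h (act (P.ω₁ / 2) g w), analyticAt_const.mul (hh.comp (analyticAt_act _ _ _)), ?_⟩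
  filter_upwards [(analyticAt_act (P.ω₁ / 2) g z).continuousAt.eventually hs] with w hw h0
  have h1 : div4 P (proj P (act (P.ω₁ / 2) g w)) = 0 := by rw [proj_act, div4_act]; exact h0
  have h2 : offAct P g ⟨proj P w, h0⟩ = ⟨proj P (act (P.ω₁ / 2) g w), h1⟩ :=
    Subtype.ext (proj_act P g w).symm
  rw [h2, hw h1, proj_act, div4_act, act_sub, zsmul_eq_mul, mul_zpow]
  ring

/-! ### The representations of `G` on spaces of sections -/

/-- `G = (ℤ/2)²`, written multiplicatively. -/
abbrev G : Type := Multiplicative (ZMod 2 × ZMod 2)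

def g₁ : G := Multiplicative.ofAdd (1, 0)

def g₂ : G := Multiplicative.ofAdd (0, 1)

/-- The subspace on which `G` acts through the character `χ` with `χ(g₁) = ε₁`, `χ(g₂) = ε₂`. -/
def eigenspace {V : Type*} [AddCommGroup V] [Module ℂ V] (ρ : Representation ℂ G V)
    (ε₁ ε₂ : ℤˣ) : Submodule ℂ V where
  carrier := {v | ρ g₁ v = ((ε₁ : ℤ) : ℂ) • v ∧ ρ g₂ v = ((ε₂ : ℤ) : ℂ) • v}
  zero_mem' := by simp
  add_mem' := by
    rintro v w ⟨h1, h2⟩ ⟨h3, h4⟩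
    exact ⟨by rw [map_add, h1, h3, smul_add], by rw [map_add, h2, h4, smul_add]⟩
  smul_mem' := by
    rintro c v ⟨h1, h2⟩
    exact ⟨by rw [map_smul, h1, smul_comm], by rw [map_smul, h2, smul_comm]⟩

/-- `G` acts on `H⁰(E, 𝒪(2[o] + 2[e/2]))` by pullback of meromorphic functions, where
`g₁(z) = z + e/2` and `g₂(z) = -z`. (Every element of `G` is its own inverse, so pullback by `g`
and by `g⁻¹` agree.) -/
def rep₁ (P : PeriodPair) : Representation ℂ G (H0 (div4 P)) where
  toFun g :=
    { toFun := fun s => ⟨fun x => s.1 (offAct P g.toAdd x),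
        fun z => isSectionAt_comp P g.toAdd s.1 z (s.2 _)⟩
      map_add' := fun _ _ => rfl
      map_smul' := fun _ _ => rfl }
  map_one' := by
    ext s x
    exact congrArg s.1 (offAct_zero P x)
  map_mul' g g' := by
    ext s x
    exact congrArg s.1 (offAct_add P g.toAdd g'.toAdd x)

/-- Interchange of the two factors of `G`. -/
def swapG : G →* G :=
  AddMonoidHom.toMultiplicative (AddEquiv.prodComm (M := ZMod 2) (N := ZMod 2)).toAddMonoidHom

/-- The same with `g₁(z) = -z` and `g₂(z) = z + e/2`. -/
def rep₂ (Q : PeriodPair) : Representation ℂ G (H0 (div4 Q)) := (rep₁ Q).comp swapG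

/-- `V₁^{ε₁ε₂}`. -/
abbrev V₁ (P : PeriodPair) (ε₁ ε₂ : ℤˣ) : Submodule ℂ (H0 (div4 P)) := eigenspace (rep₁ P) ε₁ ε₂

/-- `V₂^{ε₁ε₂}`. -/
abbrev V₂ (Q : PeriodPair) (ε₁ ε₂ : ℤˣ) : Submodule ℂ (H0 (div4 Q)) := eigenspace (rep₂ Q) ε₁ ε₂

/-- The space of sections of the bundle of type `(4,4)`,
`H⁰(E₁ × E₂, p₁^* 𝒪(2[o₁] + 2[e₁/2]) ⊗ p₂^* 𝒪(2[o₂] + 2[e₂/2]))`. -/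
abbrev H44 (P Q : PeriodPair) : Submodule ℂ (Off (div4 P) × Off (div4 Q) → ℂ) :=
  boxH0 (div4 P) (div4 Q)

lemma isBoxSectionAt_comp (P Q : PeriodPair) (g g' : ZMod 2 × ZMod 2)
    (F : Off (div4 P) × Off (div4 Q) → ℂ) (z : ℂ × ℂ)
    (hF : IsBoxSectionAt (div4 P) (div4 Q) F
      (act (P.ω₁ / 2) g z.1, act (Q.ω₁ / 2) g' z.2)) :
    IsBoxSectionAt (div4 P) (div4 Q) (fun x => F (offAct P g x.1, offAct Q g' x.2)) z := by
  obtain ⟨n, h, s, t, hh, hs, ht, e⟩ := hF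
  have an : AnalyticAt ℂ
      (fun w : ℂ × ℂ => (act (P.ω₁ / 2) g w.1, act (Q.ω₁ / 2) g' w.2)) z :=
    ((analyticAt_act _ g z.1).comp analyticAt_fst).prod
      ((analyticAt_act _ g' z.2).comp analyticAt_snd)
  refine ⟨n, fun k w => h k (act (P.ω₁ / 2) g w.1, act (Q.ω₁ / 2) g' w.2),
    fun k x => s k (offAct P g x), fun k y => t k (offAct Q g' y),
    fun k => AnalyticAt.fun_comp (hh k) an, fun k => isSectionAt_comp P g _ _ (hs k),
    fun k => isSectionAt_comp Q g' _ _ (ht k), ?_⟩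
  filter_upwards [an.continuousAt.eventually e] with w hw h0 h0'
  have h1 : div4 P (proj P (act (P.ω₁ / 2) g w.1)) = 0 := by
    rw [proj_act, div4_act]; exact h0
  have h1' : div4 Q (proj Q (act (Q.ω₁ / 2) g' w.2)) = 0 := by
    rw [proj_act, div4_act]; exact h0'
  have h2 : offAct P g ⟨proj P w.1, h0⟩ = ⟨proj P (act (P.ω₁ / 2) g w.1), h1⟩ :=
    Subtype.ext (proj_act P g w.1).symm
  have h2' : offAct Q g' ⟨proj Q w.2, h0'⟩ = ⟨proj Q (act (Q.ω₁ / 2) g' w.2), h1'⟩ :=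
    Subtype.ext (proj_act Q g' w.2).symm
  simp only [h2, h2']
  exact hw h1 h1'

/-- `G` acts by pullback on the sections of the bundle of type `(4,4)`, where
`g₁(z₁, z₂) = (z₁ + e₁/2, -z₂)` and `g₂(z₁, z₂) = (-z₁, z₂ + e₂/2)`. -/
def rep44 (P Q : PeriodPair) : Representation ℂ G (H44 P Q) where
  toFun g :=
    { toFun := fun F => ⟨fun x => F.1 (offAct P g.toAdd x.1, offAct Q (swapG g).toAdd x.2),
        fun z => isBoxSectionAt_comp P Q g.toAdd (swapG g).toAdd F.1 z (F.2 _)⟩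
      map_add' := fun _ _ => rfl
      map_smul' := fun _ _ => rfl }
  map_one' := by
    ext F x
    exact congrArg F.1 (Prod.ext (offAct_zero P x.1) (offAct_zero Q x.2))
  map_mul' g g' := by
    ext F x
    exact congrArg F.1 (Prod.ext (offAct_add P g.toAdd g'.toAdd x.1)
      (offAct_add Q (swapG g).toAdd (swapG g').toAdd x.2))

/-- The canonical map `H⁰(E₁, L₁) ⊗ H⁰(E₂, L₂) → H⁰(E₁ × E₂, p₁^* L₁ ⊗ p₂^* L₂)`,
`s ⊗ t ↦ p₁^* s ⊗ p₂^* t`. -/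
def kunneth (P Q : PeriodPair) : H0 (div4 P) ⊗[ℂ] H0 (div4 Q) →ₗ[ℂ] H44 P Q :=
  TensorProduct.lift (LinearMap.mk₂ ℂ
    (fun s t => ⟨fun x => s.1 x.1 * t.1 x.2, fun z => ⟨1, fun _ _ => 1, fun _ => s.1, fun _ => t.1,
      fun _ => analyticAt_const, fun _ => s.2 z.1, fun _ => t.2 z.2, by simp⟩⟩)
    (fun s s' t => by ext x; exact add_mul _ _ _)
    (fun c s t => by ext x; exact mul_assoc _ _ _)
    (fun s t t' => by ext x; exact mul_add _ _ _)
    (fun c s t => by ext x; exact mul_left_comm _ _ _))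

/-- The restriction of the canonical map to `A ⊗ B` for subspaces `A ⊆ H⁰(E₁, L₁)`,
`B ⊆ H⁰(E₂, L₂)`. -/
def kunnethOn {P Q : PeriodPair} (A : Submodule ℂ (H0 (div4 P))) (B : Submodule ℂ (H0 (div4 Q))) :
    A ⊗[ℂ] B →ₗ[ℂ] H44 P Q :=
  kunneth P Q ∘ₗ TensorProduct.map A.subtype B.subtype

end KeumNaie

end

/-!
A section of `𝒪(2[o] + 2[e/2])` is an elliptic function `S` for the lattice `Λ = ℤe ⊕ ℤe'`, with at
most double poles over `o` and `e/2` (`lift`, `sectionOf`). An elliptic function without poles is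
constant, and an eigensection for `G` has the same order at `e/2` as at `o`, of the parity given by
the sign of `g₂` (`sign_eq_of_order`). Therefore, once an eigenspace contains a function with a pole
at `o`, each of its members is a multiple of that function plus a constant
(`exists_eq_smul_add_smul_oneSection`). Such functions are `℘(z) ± ℘(z + e/2)`, for the characters
`++` and `-+`, and `℘'(z) (℘(z - e/2) - ℘(e/2))`, for the character `--`. The character `+-` does
not occur (`eq_zero_of_mem_V₁_one_neg_one`): for such an `S` the function `S(z) S(z - e/4)` is
holomorphic, hence constant, and it vanishes at `e'/2`. So `1` and these three functions are a basis
of eigenvectors of `H⁰`, with signs `++`, `++`, `--`, `-+`; on the second factor the two signs are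
interchanged.

The canonical map `H₁ ⊗ H₂ → H` is bijective (`kunneth_injective`, `kunneth_surjective`): the
restriction of a section `F` of the box product to a fibre is a section of the other factor, the
coefficients of `F(x, ·)` in a basis of `H₂` are linear combinations of values `F(x, y)`, and so
they are sections in `x`. The sixteen products of basis vectors are then a basis of eigenvectors
of `H`, and both assertions are read off from their signs: an eigenspace is spanned by the basis
vectors with its signs (`eigenspace_eq_span`), and injectivity on the direct sums follows by
comparing dimensions.
-/

noncomputable section

namespace KeumNaie

open Filter

/-! ### Meromorphic functions: symmetry, leading coefficients, Liouville's theorem -/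

lemma meromorphicOrderAt_add_of_periodic {S : ℂ → ℂ} {l : ℂ} (hS : ∀ z, S (z + l) = S z) (z : ℂ) :
    meromorphicOrderAt S (z + l) = meromorphicOrderAt S z := by
  rw [← meromorphicOrderAt_comp_add_const_eq_meromorphicOrderAt]
  congr 1
  funext w
  exact hS w

lemma meromorphicOrderAt_const_mul {c : ℂ} (hc : c ≠ 0) (S : ℂ → ℂ) (z : ℂ) :
    meromorphicOrderAt (fun w => c * S w) z = meromorphicOrderAt S z :=
  meromorphicOrderAt_mul_of_ne_zero (f := S) (g := fun _ => c) analyticAt_const hc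

/-- A function that is even (`ε = 1`) or odd (`ε = -1`) about `a` has even, respectively odd,
order at `a`. -/
lemma symm_sign_eq_of_order {S : ℂ → ℂ} {a ε : ℂ} {n : ℤ} (hm : MeromorphicAt S a)
    (hS : ∀ w, S (2 * a - w) = ε * S w) (hn : meromorphicOrderAt S a = n) : ε = (-1) ^ n := by
  obtain ⟨g, hg, hga, hSg⟩ := (meromorphicOrderAt_eq_int_iff hm).1 hn
  have hrefl : Tendsto (fun w => 2 * a - w) (𝓝[≠] a) (𝓝[≠] a) := by
    refine tendsto_nhdsWithin_iff.2 ⟨?_, ?_⟩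
    · have : ContinuousAt (fun w : ℂ => 2 * a - w) a := by fun_prop
      have h := this.tendsto
      rw [show 2 * a - a = a by ring] at h
      exact h.mono_left nhdsWithin_le_nhds
    · filter_upwards [self_mem_nhdsWithin] with w hw h
      exact hw (by simp only [Set.mem_singleton_iff] at h ⊢; linear_combination -h)
  have hg' : Tendsto g (𝓝[≠] a) (𝓝 (g a)) := hg.continuousAt.tendsto.mono_left nhdsWithin_le_nhds
  have key : (fun w => (-1) ^ n * g (2 * a - w)) =ᶠ[𝓝[≠] a] fun w => ε * g w := by
    filter_upwards [hSg, hrefl.eventually hSg, self_mem_nhdsWithin] with w h1 h2 hw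
    have hwa : w - a ≠ 0 := sub_ne_zero.2 hw
    have h3 := hS w
    rw [h1, h2, show 2 * a - w - a = (-1) * (w - a) by ring, mul_zpow, smul_eq_mul,
      smul_eq_mul] at h3
    refine mul_left_cancel₀ (zpow_ne_zero n hwa) ?_
    linear_combination h3
  have := tendsto_nhds_unique (((hg'.comp hrefl).const_mul ((-1) ^ n)).congr' key)
    (hg'.const_mul ε)
  exact (mul_right_cancel₀ hga this).symm

/-- Subtracting a suitable multiple of `T` removes the leading term of `S`. -/
lemma exists_order_sub_mul_ge {S T : ℂ → ℂ} {z : ℂ} {n : ℤ} (hS : MeromorphicAt S z)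
    (hT : meromorphicOrderAt T z = n) (hTm : MeromorphicAt T z)
    (hn : (n : WithTop ℤ) ≤ meromorphicOrderAt S z) :
    ∃ a : ℂ, ((n + 1 : ℤ) : WithTop ℤ) ≤ meromorphicOrderAt (fun w => S w - a * T w) z := by
  have hQ : 0 ≤ meromorphicOrderAt (S / T) z := by
    rw [meromorphicOrderAt_div hS hTm, hT]
    cases h : meromorphicOrderAt S z with
    | top => exact le_top
    | coe m =>
      rw [h] at hn
      have : n ≤ m := by exact_mod_cast hn
      have : (0 : ℤ) ≤ m - n := by omega
      exact_mod_cast this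
  obtain ⟨a, ha⟩ := tendsto_nhds_of_meromorphicOrderAt_nonneg (hS.div hTm) hQ
  refine ⟨a, ?_⟩
  have hsub : MeromorphicAt (fun w => (S / T) w - a) z := (hS.div hTm).sub (.const a z)
  have hpos : 0 < meromorphicOrderAt (fun w => (S / T) w - a) z := by
    rw [← tendsto_zero_iff_meromorphicOrderAt_pos hsub, ← sub_self a]
    exact ha.sub_const a
  have hT0 : ∀ᶠ w in 𝓝[≠] z, T w ≠ 0 :=
    (meromorphicOrderAt_ne_top_iff_eventually_ne_zero hTm).1 (by rw [hT]; exact WithTop.coe_ne_top)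
  have heq : (fun w => S w - a * T w) =ᶠ[𝓝[≠] z] T * fun w => (S / T) w - a := by
    filter_upwards [hT0] with w hw
    simp only [Pi.mul_apply, Pi.div_apply]
    field_simp
  rw [meromorphicOrderAt_congr heq, meromorphicOrderAt_mul hTm hsub, hT]
  cases h : meromorphicOrderAt (fun w => (S / T) w - a) z with
  | top => exact le_top
  | coe m =>
    rw [h] at hpos
    have : 0 < m := by exact_mod_cast hpos
    have : n + 1 ≤ n + m := by omega
    exact_mod_cast this

/-- An elliptic function without poles is constant. As no value is prescribed at removable
singularities, constancy holds on punctured neighbourhoods. -/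
lemma elliptic_eventually_const (P : PeriodPair) {S : ℂ → ℂ}
    (hper : ∀ z, ∀ l ∈ P.lattice, S (z + l) = S z) (hm : ∀ z, MeromorphicAt S z)
    (ho : ∀ z, 0 ≤ meromorphicOrderAt S z) : ∃ c, ∀ z, ∀ᶠ w in 𝓝[≠] z, S w = c := by
  have hmU : MeromorphicOn S Set.univ := fun z _ => hm z
  set T := toMeromorphicNFOn S Set.univ with hTdef
  have hTS : ∀ z, T =ᶠ[𝓝[≠] z] S := fun z =>
    hmU.toMeromorphicNFOn_eq_self_on_nhdsNE (Set.mem_univ z)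
  have hTa : ∀ z, AnalyticAt ℂ T z := fun z => by
    refine (meromorphicNFOn_toMeromorphicNFOn S Set.univ
      (Set.mem_univ z)).meromorphicOrderAt_nonneg_iff_analyticAt.1 ?_
    rw [meromorphicOrderAt_congr (hTS z)]
    exact ho z
  have hTd : Differentiable ℂ T := fun z => (hTa z).differentiableAt
  have hTper : ∀ z l, l ∈ P.lattice → T (z + l) = T z := by
    intro z l hl
    have hshift : Tendsto (fun w => w + l) (𝓝[≠] z) (𝓝[≠] (z + l)) := by
      refine tendsto_nhdsWithin_iff.2 ⟨?_, ?_⟩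
      · exact ((continuous_add_const l).tendsto z).mono_left nhdsWithin_le_nhds
      · filter_upwards [self_mem_nhdsWithin] with w hw h
        exact hw (add_right_cancel h)
    have h1 : Tendsto (fun w => T (w + l)) (𝓝[≠] z) (𝓝 (T (z + l))) :=
      ((hTd.continuous.tendsto (z + l)).mono_left nhdsWithin_le_nhds).comp hshift
    have h2 : Tendsto T (𝓝[≠] z) (𝓝 (T z)) :=
      (hTd.continuous.tendsto z).mono_left nhdsWithin_le_nhds
    refine tendsto_nhds_unique (h1.congr' ?_) h2
    filter_upwards [hTS z, hshift.eventually (hTS (z + l))] with w ha hb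
    rw [hb, ha, hper w l hl]
  have hb := (IsZLattice.isCompact_range_of_periodic P.lattice T hTd.continuous hTper).isBounded
  exact ⟨T 0, fun z => (hTS z).mono fun w hw => by rw [← hw, hTd.apply_eq_apply_of_bounded hb w 0]⟩

lemma analyticAt_eq_of_eventually_punctured {S : ℂ → ℂ} {z c : ℂ} (hS : AnalyticAt ℂ S z)
    (h : ∀ᶠ w in 𝓝[≠] z, S w = c) : S z = c :=
  tendsto_nhds_unique (hS.continuousAt.tendsto.mono_left nhdsWithin_le_nhds)
    (tendsto_const_nhds.congr' (h.mono fun _ hw => hw.symm))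

/-! ### Sections of `𝒪(2[o] + 2[e/2])` as elliptic functions -/

variable {P : PeriodPair}

lemma proj_eq_zero_iff {z : ℂ} : proj P z = 0 ↔ z ∈ P.lattice :=
  Submodule.Quotient.mk_eq_zero _

lemma proj_add_of_mem {l : ℂ} (hl : l ∈ P.lattice) (z : ℂ) : proj P (z + l) = proj P z := by
  rw [proj, map_add, show P.lattice.mkQ l = 0 from proj_eq_zero_iff.2 hl, add_zero]

lemma proj_eq_half_iff {z : ℂ} : proj P z = half P ↔ z - P.ω₁ / 2 ∈ P.lattice := by
  rw [← proj_eq_zero_iff, proj, proj, map_sub, sub_eq_zero, half]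

lemma half_ne_zero : half P ≠ 0 := fun h => P.ω₁_div_two_notMem_lattice (proj_eq_zero_iff.1 h)

lemma div4_zero : div4 P 0 = 2 := by
  simp [div4, half_ne_zero]

lemma div4_half : div4 P (half P) = 2 := by
  simp [div4, half_ne_zero.symm]

lemma div4_of_ne {x : Torus P} (h0 : x ≠ 0) (h1 : x ≠ half P) : div4 P x = 0 := by
  simp [div4, h0.symm, h1.symm]

lemma div4_nonneg (x : Torus P) : 0 ≤ div4 P x := by
  by_cases h0 : x = 0
  · rw [h0, div4_zero]; norm_num
  · by_cases h1 : x = half P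
    · rw [h1, div4_half]; norm_num
    · rw [div4_of_ne h0 h1]

lemma div4_proj_eq_zero_iff {z : ℂ} :
    div4 P (proj P z) = 0 ↔ z ∉ P.lattice ∧ z - P.ω₁ / 2 ∉ P.lattice := by
  rw [← proj_eq_zero_iff, ← proj_eq_half_iff]
  refine ⟨fun h => ⟨fun h0 => ?_, fun h0 => ?_⟩, fun h => div4_of_ne h.1 h.2⟩
  · rw [h0, div4_zero] at h; norm_num at h
  · rw [h0, div4_half] at h; norm_num at h

lemma eventually_notMem_lattice (z : ℂ) : ∀ᶠ w in 𝓝[≠] z, w ∉ P.lattice := by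
  filter_upwards [nhdsWithin_le_nhds (P.compl_lattice_sdiff_singleton_mem_nhds z),
    self_mem_nhdsWithin] with w h1 h2 h3
  exact h1 ⟨h3, h2⟩

lemma tendsto_sub_nhdsNE (z a : ℂ) : Tendsto (fun w => w - a) (𝓝[≠] z) (𝓝[≠] (z - a)) := by
  refine tendsto_nhdsWithin_iff.2 ⟨?_, ?_⟩
  · exact ((continuous_id.sub continuous_const).tendsto z).mono_left nhdsWithin_le_nhds
  · filter_upwards [self_mem_nhdsWithin] with w hw h
    exact hw (sub_left_injective h)

lemma eventually_div4_eq_zero (z : ℂ) : ∀ᶠ w in 𝓝[≠] z, div4 P (proj P w) = 0 := by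
  filter_upwards [eventually_notMem_lattice z, (tendsto_sub_nhdsNE z (P.ω₁ / 2)).eventually
    (eventually_notMem_lattice (z - P.ω₁ / 2))] with w h1 h2
  exact div4_proj_eq_zero_iff.2 ⟨h1, h2⟩

/-- The elliptic function on `ℂ` given by a function on the complement of `{o, e/2}`. It takes the
value `0` at the points over `o` and `e/2`, so that it inherits every symmetry exactly. -/
def lift (s : Off (div4 P) → ℂ) (w : ℂ) : ℂ :=
  if hw : div4 P (proj P w) = 0 then s ⟨proj P w, hw⟩ else 0

lemma lift_of_off (s : Off (div4 P) → ℂ) {w : ℂ} (hw : div4 P (proj P w) = 0) :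
    lift s w = s ⟨proj P w, hw⟩ := dif_pos hw

lemma lift_congr (s : Off (div4 P) → ℂ) {w w' : ℂ} (h : proj P w = proj P w') :
    lift s w = lift s w' := by
  simp only [lift, h]

lemma lift_add (s t : Off (div4 P) → ℂ) (w : ℂ) : lift (s + t) w = lift s w + lift t w := by
  unfold lift; split_ifs <;> simp

lemma lift_smul (c : ℂ) (s : Off (div4 P) → ℂ) (w : ℂ) : lift (c • s) w = c * lift s w := by
  unfold lift; split_ifs <;> simp

lemma lift_offAct (g : ZMod 2 × ZMod 2) (s : Off (div4 P) → ℂ) (w : ℂ) :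
    lift (fun x => s (offAct P g x)) w = lift s (act (P.ω₁ / 2) g w) := by
  unfold lift
  have h : div4 P (proj P (act (P.ω₁ / 2) g w)) = div4 P (proj P w) := by rw [proj_act, div4_act]
  by_cases hw : div4 P (proj P w) = 0
  · rw [dif_pos hw, dif_pos (h.trans hw)]
    exact congrArg s (Subtype.ext (proj_act P g w).symm)
  · rw [dif_neg hw, dif_neg (by rwa [h])]

lemma lift_add_lattice (s : Off (div4 P) → ℂ) {l : ℂ} (hl : l ∈ P.lattice) (z : ℂ) :
    lift s (z + l) = lift s z := lift_congr s (proj_add_of_mem hl z)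

lemma ext_of_lift {s t : H0 (div4 P)}
    (h : ∀ w, div4 P (proj P w) = 0 → lift s.1 w = lift t.1 w) : s = t := by
  refine Subtype.ext (funext fun x => ?_)
  obtain ⟨w, hw⟩ := P.lattice.mkQ_surjective x.1
  have hx : div4 P (proj P w) = 0 := by rw [proj, hw]; exact x.2
  have := h w hx
  rw [lift_of_off _ hx, lift_of_off _ hx] at this
  have e : x = ⟨proj P w, hx⟩ := Subtype.ext hw.symm
  rw [e, this]

lemma meromorphicAt_lift (s : H0 (div4 P)) (z : ℂ) : MeromorphicAt (lift s.1) z := by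
  obtain ⟨h, hh, hs⟩ := s.2 z
  refine MeromorphicAt.congr (f := fun w => (w - z) ^ (-div4 P (proj P z)) * h w) ?_ ?_
  · have := hh.meromorphicAt
    fun_prop
  · filter_upwards [eventually_div4_eq_zero z, nhdsWithin_le_nhds hs] with w h1 h2
    rw [lift_of_off _ h1, h2 h1]

lemma order_lift_ge (s : H0 (div4 P)) (z : ℂ) :
    ((-div4 P (proj P z) : ℤ) : WithTop ℤ) ≤ meromorphicOrderAt (lift s.1) z := by
  obtain ⟨h, hh, hs⟩ := s.2 z
  have e : lift s.1 =ᶠ[𝓝[≠] z] (fun w => (w - z) ^ (-div4 P (proj P z))) * h := by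
    filter_upwards [eventually_div4_eq_zero z, nhdsWithin_le_nhds hs] with w h1 h2
    rw [lift_of_off _ h1, h2 h1, Pi.mul_apply]
  rw [meromorphicOrderAt_congr e, meromorphicOrderAt_mul (by fun_prop) hh.meromorphicAt,
    fun_meromorphicOrderAt_zpow_id_sub_const]
  exact le_add_of_nonneg_right hh.meromorphicOrderAt_nonneg

lemma analyticAt_lift (s : H0 (div4 P)) {z : ℂ} (hz : div4 P (proj P z) = 0) :
    AnalyticAt ℂ (lift s.1) z := by
  obtain ⟨h, hh, hs⟩ := s.2 z
  refine hh.congr ?_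
  have e : lift s.1 =ᶠ[𝓝[≠] z] h := by
    filter_upwards [eventually_div4_eq_zero z, nhdsWithin_le_nhds hs] with w h1 h2
    rw [lift_of_off _ h1, h2 h1, hz]; simp
  have h0 : lift s.1 z = h z := by
    rw [lift_of_off _ hz, hs.self_of_nhds hz, hz]; simp
  exact (eventuallyEq_nhds_of_eventuallyEq_nhdsNE e h0).symm

lemma apply_surjInv_proj {S : ℂ → ℂ} (hper : ∀ z, ∀ l ∈ P.lattice, S (z + l) = S z) (w : ℂ) :
    S (Function.surjInv P.lattice.mkQ_surjective (proj P w)) = S w := by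
  have hl : Function.surjInv P.lattice.mkQ_surjective (proj P w) - w ∈ P.lattice := by
    rw [← proj_eq_zero_iff, proj, map_sub, sub_eq_zero]
    exact Function.surjInv_eq P.lattice.mkQ_surjective _
  rw [← hper w _ hl, add_sub_cancel]

/-- An elliptic function with at most double poles over `o` and `e/2` and no others, as a
section. -/
def sectionOf (S : ℂ → ℂ) (hper : ∀ z, ∀ l ∈ P.lattice, S (z + l) = S z)
    (ho : ∀ z, ((-div4 P (proj P z) : ℤ) : WithTop ℤ) ≤ meromorphicOrderAt S z)
    (hm : ∀ z, MeromorphicAt S z) (ha : ∀ z, div4 P (proj P z) = 0 → AnalyticAt ℂ S z) :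
    H0 (div4 P) :=
  ⟨fun x => S (Function.surjInv P.lattice.mkQ_surjective x.1), by
    have hS := apply_surjInv_proj hper
    intro z
    by_cases hz : div4 P (proj P z) = 0
    · exact ⟨S, ha z hz, .of_forall fun w hw => by
        beta_reduce
        rw [hS w, hz, neg_zero, zpow_zero, one_mul]⟩
    · have hR : 0 ≤ meromorphicOrderAt ((fun w => (w - z) ^ (div4 P (proj P z))) * S) z := by
        rw [meromorphicOrderAt_mul (by fun_prop) (hm z), fun_meromorphicOrderAt_zpow_id_sub_const]
        have h := ho z
        cases h' : meromorphicOrderAt S z with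
        | top => exact le_top
        | coe m =>
          rw [h'] at h
          have h : -div4 P (proj P z) ≤ m := by exact_mod_cast h
          have : 0 ≤ div4 P (proj P z) + m := by omega
          exact_mod_cast this
      obtain ⟨g, hg, hgS⟩ := (MeromorphicAt.meromorphicOrderAt_nonneg_iff
        (by have := hm z; fun_prop)).1 hR
      refine ⟨g, hg, ?_⟩
      filter_upwards [eventually_nhdsWithin_iff.1 hgS] with w h1 hw
      have hwz : w ≠ z := by rintro rfl; exact hz hw
      have hne : w - z ≠ 0 := sub_ne_zero.2 hwz
      rw [hS w, ← h1 hwz, Pi.mul_apply, ← mul_assoc, ← zpow_add₀ hne, neg_add_cancel, zpow_zero,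
        one_mul]⟩

lemma lift_sectionOf {S : ℂ → ℂ} {hper : ∀ z, ∀ l ∈ P.lattice, S (z + l) = S z}
    {ho : ∀ z, ((-div4 P (proj P z) : ℤ) : WithTop ℤ) ≤ meromorphicOrderAt S z}
    {hm : ∀ z, MeromorphicAt S z} {ha : ∀ z, div4 P (proj P z) = 0 → AnalyticAt ℂ S z}
    {w : ℂ} (hw : div4 P (proj P w) = 0) : lift (sectionOf S hper ho hm ha).1 w = S w := by
  rw [lift_of_off _ hw]
  exact apply_surjInv_proj hper w

lemma lift_sectionOf_eventuallyEq {S : ℂ → ℂ} {hper : ∀ z, ∀ l ∈ P.lattice, S (z + l) = S z}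
    {ho : ∀ z, ((-div4 P (proj P z) : ℤ) : WithTop ℤ) ≤ meromorphicOrderAt S z}
    {hm : ∀ z, MeromorphicAt S z} {ha : ∀ z, div4 P (proj P z) = 0 → AnalyticAt ℂ S z} (z : ℂ) :
    lift (sectionOf S hper ho hm ha).1 =ᶠ[𝓝[≠] z] S :=
  (eventually_div4_eq_zero z).mono fun _ hw => lift_sectionOf hw

/-- The constant function `1`, as a section. -/
def oneSection (P : PeriodPair) : H0 (div4 P) :=
  ⟨fun _ => 1, fun z => by
    refine ⟨fun w => (w - z) ^ (div4 P (proj P z)).toNat, by fun_prop, .of_forall fun w hw => ?_⟩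
    beta_reduce
    rw [← zpow_natCast, Int.toNat_of_nonneg (div4_nonneg _)]
    by_cases hwz : w = z
    · subst hwz
      rw [hw, neg_zero, zpow_zero, mul_one]
    · rw [← zpow_add₀ (sub_ne_zero.2 hwz), neg_add_cancel, zpow_zero]⟩

lemma lift_oneSection {w : ℂ} (hw : div4 P (proj P w) = 0) : lift (oneSection P).1 w = 1 :=
  lift_of_off _ hw

/-- A section without poles is constant. -/
lemma exists_eq_smul_oneSection {s : H0 (div4 P)} (h0 : 0 ≤ meromorphicOrderAt (lift s.1) 0)
    (h1 : 0 ≤ meromorphicOrderAt (lift s.1) (P.ω₁ / 2)) : ∃ c : ℂ, s = c • oneSection P := by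
  have ho : ∀ z, 0 ≤ meromorphicOrderAt (lift s.1) z := by
    intro z
    by_cases hz : div4 P (proj P z) = 0
    · exact (analyticAt_lift s hz).meromorphicOrderAt_nonneg
    · rw [div4_proj_eq_zero_iff, not_and_or, not_not, not_not] at hz
      rcases hz with hz | hz
      · rw [← zero_add z, meromorphicOrderAt_add_of_periodic (lift_add_lattice s.1 hz)]
        exact h0
      · rw [← add_sub_cancel (P.ω₁ / 2) z,
          meromorphicOrderAt_add_of_periodic (lift_add_lattice s.1 hz)]
        exact h1
  obtain ⟨c, hc⟩ := elliptic_eventually_const P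
    (fun z l hl => lift_add_lattice s.1 hl z) (meromorphicAt_lift s) ho
  refine ⟨c, ext_of_lift fun w hw => ?_⟩
  rw [analyticAt_eq_of_eventually_punctured (analyticAt_lift s hw) (hc w), Submodule.coe_smul,
    lift_smul, lift_oneSection hw, mul_one]

/-! ### Eigensections: parity and reduction modulo a section with a pole -/

lemma lift_rep_g₁ (s : H0 (div4 P)) (w : ℂ) :
    lift (rep₁ P g₁ s).1 w = lift s.1 (w + P.ω₁ / 2) := by
  refine (lift_offAct (1, 0) s.1 w).trans ?_
  have v1 : (1 : ZMod 2).val = 1 := rfl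
  simp [act, v1]

lemma lift_rep_g₂ (s : H0 (div4 P)) (w : ℂ) : lift (rep₁ P g₂ s).1 w = lift s.1 (-w) := by
  refine (lift_offAct (0, 1) s.1 w).trans ?_
  have v1 : (1 : ZMod 2).val = 1 := rfl
  simp [act, v1]

lemma mem_V₁_iff {s : H0 (div4 P)} {ε₁ ε₂ : ℤˣ} : s ∈ V₁ P ε₁ ε₂ ↔
    (∀ w, lift s.1 (w + P.ω₁ / 2) = ((ε₁ : ℤ) : ℂ) * lift s.1 w) ∧
      ∀ w, lift s.1 (-w) = ((ε₂ : ℤ) : ℂ) * lift s.1 w := by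
  refine and_congr ⟨fun h w => ?_, fun h => ext_of_lift fun w _ => ?_⟩
    ⟨fun h w => ?_, fun h => ext_of_lift fun w _ => ?_⟩
  · rw [← lift_rep_g₁, h, Submodule.coe_smul, lift_smul]
  · rw [lift_rep_g₁, h, Submodule.coe_smul, lift_smul]
  · rw [← lift_rep_g₂, h, Submodule.coe_smul, lift_smul]
  · rw [lift_rep_g₂, h, Submodule.coe_smul, lift_smul]

lemma sign_ne_zero (ε : ℤˣ) : ((ε : ℤ) : ℂ) ≠ 0 := by
  exact_mod_cast ε.ne_zero

lemma order_lift_add_half {s : H0 (div4 P)} {ε₁ ε₂ : ℤˣ} (hs : s ∈ V₁ P ε₁ ε₂) (z : ℂ) :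
    meromorphicOrderAt (lift s.1) (z + P.ω₁ / 2) = meromorphicOrderAt (lift s.1) z := by
  rw [← meromorphicOrderAt_comp_add_const_eq_meromorphicOrderAt,
    ← meromorphicOrderAt_const_mul (sign_ne_zero ε₁) (lift s.1) z]
  congr 1
  funext w
  exact (mem_V₁_iff.1 hs).1 w

lemma neg_two_le_order_lift (s : H0 (div4 P)) :
    ((-2 : ℤ) : WithTop ℤ) ≤ meromorphicOrderAt (lift s.1) 0 := by
  have := order_lift_ge s 0
  rwa [show proj P 0 = 0 from map_zero _, div4_zero] at this

/-- The order at `o` of an eigensection has the parity prescribed by the sign of `g₂`. -/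
lemma sign_eq_of_order {s : H0 (div4 P)} {ε₁ ε₂ : ℤˣ} (hs : s ∈ V₁ P ε₁ ε₂) {n : ℤ}
    (hn : meromorphicOrderAt (lift s.1) 0 = n) : ((ε₂ : ℤ) : ℂ) = (-1) ^ n :=
  symm_sign_eq_of_order (meromorphicAt_lift s 0)
    (fun w => by rw [mul_zero, zero_sub, (mem_V₁_iff.1 hs).2]) hn

lemma succ_le_order_lift {s : H0 (div4 P)} {ε₁ ε₂ : ℤˣ} (hs : s ∈ V₁ P ε₁ ε₂) {n : ℤ}
    (hε : ((ε₂ : ℤ) : ℂ) ≠ (-1) ^ n) (hn : (n : WithTop ℤ) ≤ meromorphicOrderAt (lift s.1) 0) :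
    ((n + 1 : ℤ) : WithTop ℤ) ≤ meromorphicOrderAt (lift s.1) 0 := by
  cases h : meromorphicOrderAt (lift s.1) 0 with
  | top => exact le_top
  | coe m =>
    rw [h] at hn
    have h1 : n ≤ m := by exact_mod_cast hn
    have h2 : n ≠ m := by
      rintro rfl
      exact hε (sign_eq_of_order hs h)
    have : n + 1 ≤ m := by omega
    exact_mod_cast this

lemma exists_eq_smul_oneSection_of_mem {s : H0 (div4 P)} {ε₁ ε₂ : ℤˣ} (hs : s ∈ V₁ P ε₁ ε₂)
    (h0 : 0 ≤ meromorphicOrderAt (lift s.1) 0) : ∃ c : ℂ, s = c • oneSection P := by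
  refine exists_eq_smul_oneSection h0 ?_
  rw [← zero_add (P.ω₁ / 2), order_lift_add_half hs]
  exact h0

lemma oneSection_mem : oneSection P ∈ V₁ P 1 1 :=
  ⟨by simp only [Units.val_one, Int.cast_one, one_smul]; rfl,
    by simp only [Units.val_one, Int.cast_one, one_smul]; rfl⟩

/-- The only constant eigensection for a nontrivial character is `0`. -/
lemma smul_oneSection_eq_zero {c : ℂ} {ε₁ ε₂ : ℤˣ} (hs : c • oneSection P ∈ V₁ P ε₁ ε₂)
    (hε : ε₁ = -1 ∨ ε₂ = -1) : c • oneSection P = 0 := by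
  have h1 := (V₁ P 1 1).smul_mem c oneSection_mem
  have key : ∀ x : H0 (div4 P), -x = x → x = 0 := fun x hx => by
    have h2 : (2 : ℂ) • x = 0 := by
      rw [two_smul]
      exact add_eq_zero_iff_eq_neg.2 hx.symm
    exact (smul_eq_zero.1 h2).resolve_left two_ne_zero
  rcases hε with rfl | rfl
  · have := hs.1.symm.trans h1.1
    exact key _ (by simpa only [Units.val_neg, Units.val_one, Int.cast_neg, Int.cast_one, neg_smul,
      one_smul] using this)
  · have := hs.2.symm.trans h1.2
    exact key _ (by simpa only [Units.val_neg, Units.val_one, Int.cast_neg, Int.cast_one, neg_smul,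
      one_smul] using this)

/-- If an eigenspace has a member `t` with a pole at `o`, then it lies in the span of `t` and `1`:
subtracting a multiple of `t` removes the pole, by parity also when the order of `t` is `-2`. -/
lemma exists_eq_smul_add_smul_oneSection {s t : H0 (div4 P)} {ε₁ ε₂ : ℤˣ} (hs : s ∈ V₁ P ε₁ ε₂)
    (ht : t ∈ V₁ P ε₁ ε₂) (hpole : meromorphicOrderAt (lift t.1) 0 < 0) :
    ∃ a c : ℂ, s = a • t + c • oneSection P := by
  obtain ⟨n, hn⟩ := WithTop.ne_top_iff_exists.1 hpole.ne_top
  have hn0 : n < 0 := by rw [← hn] at hpole; exact_mod_cast hpole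
  have hn2 : -2 ≤ n := by
    have := neg_two_le_order_lift t
    rw [← hn] at this; exact_mod_cast this
  have hsign := sign_eq_of_order ht hn.symm
  have hsn : (n : WithTop ℤ) ≤ meromorphicOrderAt (lift s.1) 0 := by
    obtain rfl | rfl : n = -2 ∨ n = -1 := by omega
    · exact neg_two_le_order_lift s
    · exact succ_le_order_lift hs (n := -2) (by rw [hsign]; norm_num) (neg_two_le_order_lift s)
  obtain ⟨a, ha⟩ := exists_order_sub_mul_ge (meromorphicAt_lift s 0) hn.symm
    (meromorphicAt_lift t 0) hsn
  have hu : s - a • t ∈ V₁ P ε₁ ε₂ := sub_mem hs (Submodule.smul_mem _ a ht)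
  have hlift : lift (s - a • t).1 = fun w => lift s.1 w - a * lift t.1 w := by
    funext w
    unfold lift
    split_ifs
    · rfl
    · simp
  rw [← hlift] at ha
  have h0 : 0 ≤ meromorphicOrderAt (lift (s - a • t).1) 0 := by
    obtain rfl | rfl : n = -2 ∨ n = -1 := by omega
    · exact succ_le_order_lift hu (n := -1) (by rw [hsign]; norm_num) (by simpa using ha)
    · exact ha
  obtain ⟨c, hc⟩ := exists_eq_smul_oneSection_of_mem hu h0
  exact ⟨a, c, by rw [← hc]; abel⟩

/-! ### There are no odd sections invariant under translation by `e/2` -/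

lemma notMem_lattice_of_rat {α β : ℚ} (h : α.den ≠ 1 ∨ β.den ≠ 1) {z : ℂ}
    (hz : z = α * P.ω₁ + β * P.ω₂) : z ∉ P.lattice := by
  rw [hz, P.mul_ω₁_add_mul_ω₂_mem_lattice]
  tauto

lemma div4_proj_quarter : div4 P (proj P (P.ω₁ / 4)) = 0 :=
  div4_proj_eq_zero_iff.2
    ⟨notMem_lattice_of_rat (α := 1 / 4) (β := 0) (by norm_num) (by push_cast; ring),
      notMem_lattice_of_rat (α := -1 / 4) (β := 0) (by norm_num) (by push_cast; ring)⟩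

/-- With `h = e/2`, let `s` be odd and `h`-periodic. By parity its poles are simple, and it vanishes
at each fixed point of a reflection `w ↦ c - w`, with `c` a period, that is not a pole. Hence
`s(w) s(w - h/2)` is holomorphic, the poles of each factor being zeros of the other, and it vanishes
at `e'/2`; so it is `0`. -/
lemma eq_zero_of_mem_V₁_one_neg_one {s : H0 (div4 P)} (hs : s ∈ V₁ P 1 (-1)) : s = 0 := by
  set S := lift s.1 with hSdef
  have hm : ∀ z, MeromorphicAt S z := meromorphicAt_lift s
  have hodd : ∀ w, S (-w) = -1 * S w := by simpa using (mem_V₁_iff.1 hs).2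
  have hhalf : ∀ w, S (w + P.ω₁ / 2) = S w := by simpa using (mem_V₁_iff.1 hs).1
  have hper : ∀ l ∈ P.lattice, ∀ w, S (w + l) = S w := fun l hl w => lift_add_lattice s.1 hl w
  -- `S` is odd about a fixed point of a reflection, so it vanishes there if it is regular
  have hzero : ∀ z, div4 P (proj P z) = 0 → (∀ w, S (2 * z - w) = -1 * S w) →
      (1 : WithTop ℤ) ≤ meromorphicOrderAt S z := by
    intro z hz hsymm
    have h0 := (analyticAt_lift s hz).meromorphicOrderAt_nonneg
    cases h : meromorphicOrderAt S z with
    | top => exact le_top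
    | coe m =>
      have hpar := symm_sign_eq_of_order (hm z) hsymm h
      have h0 : 0 ≤ m := by
        rw [← hSdef, h] at h0; exact_mod_cast h0
      have h1 : m ≠ 0 := by
        rintro rfl
        norm_num at hpar
      have : 1 ≤ m := by omega
      exact_mod_cast this
  have hquarter : (1 : WithTop ℤ) ≤ meromorphicOrderAt S (P.ω₁ / 4) := by
    refine hzero _ div4_proj_quarter fun w => ?_
    rw [show 2 * (P.ω₁ / 4) - w = -w + P.ω₁ / 2 by ring, hhalf, hodd]
  have hquarter' : (1 : WithTop ℤ) ≤ meromorphicOrderAt S (0 - P.ω₁ / 4) := by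
    rw [← meromorphicOrderAt_add_of_periodic hhalf]
    convert! hquarter using 2
    ring
  have hpole : ((-1 : ℤ) : WithTop ℤ) ≤ meromorphicOrderAt S 0 :=
    succ_le_order_lift hs (n := -2) (by norm_num) (neg_two_le_order_lift s)
  set T := fun w => S w * S (w - P.ω₁ / 4) with hT
  have hm' : ∀ z, MeromorphicAt (fun w => S (w - P.ω₁ / 4)) z := fun z =>
    (hm (z - P.ω₁ / 4)).comp_analyticAt (f := S) (g := fun w => w - P.ω₁ / 4) (by fun_prop)
  have hTm : ∀ z, MeromorphicAt T z := fun z => (hm z).mul (hm' z)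
  have hTo : ∀ z, meromorphicOrderAt T z =
      meromorphicOrderAt S z + meromorphicOrderAt S (z - P.ω₁ / 4) := fun z => by
    rw [← meromorphicOrderAt_comp_sub_const_eq_meromorphicOrderAt]
    exact meromorphicOrderAt_mul (hm z) (hm' z)
  have hThalf : ∀ w, T (w + P.ω₁ / 2) = T w := fun w => by
    simp only [hT]
    rw [hhalf, show w + P.ω₁ / 2 - P.ω₁ / 4 = w - P.ω₁ / 4 + P.ω₁ / 2 by ring, hhalf]
  have hTper : ∀ l ∈ P.lattice, ∀ w, T (w + l) = T w := fun l hl w => by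
    simp only [hT]
    rw [hper l hl, show w + l - P.ω₁ / 4 = w - P.ω₁ / 4 + l by ring, hper l hl]
  -- the order of `T` is nonnegative at `0`, at `h/2`, and hence at all translates of these points
  have hneg : (0 : WithTop ℤ) = ((-1 : ℤ) : WithTop ℤ) + 1 := by norm_cast
  have hT0 : 0 ≤ meromorphicOrderAt T 0 := by
    rw [hTo, hneg]
    exact add_le_add hpole hquarter'
  have hT1 : 0 ≤ meromorphicOrderAt T (P.ω₁ / 4) := by
    rw [hTo, sub_self, hneg, add_comm]
    exact add_le_add hquarter hpole
  have hsupp : ∀ z a, 0 ≤ meromorphicOrderAt T a → div4 P (proj P (z - a)) ≠ 0 →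
      0 ≤ meromorphicOrderAt T z := by
    intro z a ha hz
    rw [Ne, div4_proj_eq_zero_iff, not_and_or, not_not, not_not] at hz
    rcases hz with hz | hz
    · rwa [← add_sub_cancel a z, meromorphicOrderAt_add_of_periodic (hTper _ hz)]
    · rwa [show z = a + P.ω₁ / 2 + (z - a - P.ω₁ / 2) by ring,
        meromorphicOrderAt_add_of_periodic (hTper _ hz), meromorphicOrderAt_add_of_periodic hThalf]
  have hTnonneg : ∀ z, 0 ≤ meromorphicOrderAt T z := by
    intro z
    by_cases hz : div4 P (proj P (z - 0)) = 0
    · by_cases hz' : div4 P (proj P (z - P.ω₁ / 4)) = 0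
      · rw [hTo]
        rw [sub_zero] at hz
        exact add_nonneg (analyticAt_lift s hz).meromorphicOrderAt_nonneg
          (analyticAt_lift s hz').meromorphicOrderAt_nonneg
      · exact hsupp z _ hT1 hz'
    · exact hsupp z 0 hT0 hz
  obtain ⟨c, hc⟩ := elliptic_eventually_const P (fun z l hl => hTper l hl z) hTm hTnonneg
  -- the constant is `0`, as `T` vanishes at `e'/2`
  have hc0 : c = 0 := by
    have ha : div4 P (proj P (P.ω₂ / 2)) = 0 := div4_proj_eq_zero_iff.2
      ⟨P.ω₂_div_two_notMem_lattice,
        notMem_lattice_of_rat (α := -1 / 2) (β := 1 / 2) (by norm_num) (by push_cast; ring)⟩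
    have hb : div4 P (proj P (P.ω₂ / 2 - P.ω₁ / 4)) = 0 := div4_proj_eq_zero_iff.2
      ⟨notMem_lattice_of_rat (α := -1 / 4) (β := 1 / 2) (by norm_num) (by push_cast; ring),
        notMem_lattice_of_rat (α := -3 / 4) (β := 1 / 2) (by norm_num) (by push_cast; ring)⟩
    have h1 : (1 : WithTop ℤ) ≤ meromorphicOrderAt S (P.ω₂ / 2) := by
      refine hzero _ ha fun w => ?_
      rw [show 2 * (P.ω₂ / 2) - w = -w + P.ω₂ by ring, hper _ P.ω₂_mem_lattice, hodd]
    have h2 : 0 < meromorphicOrderAt T (P.ω₂ / 2) := by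
      rw [hTo]
      refine lt_of_lt_of_le zero_lt_one (h1.trans ?_)
      exact le_add_of_nonneg_right (analyticAt_lift s hb).meromorphicOrderAt_nonneg
    exact (tendsto_nhds_unique (tendsto_zero_of_meromorphicOrderAt_pos h2)
      (tendsto_const_nhds.congr' ((hc _).mono fun _ h => h.symm))).symm
  have htop : meromorphicOrderAt S 0 + meromorphicOrderAt S (0 - P.ω₁ / 4) = ⊤ := by
    rw [← hTo, meromorphicOrderAt_eq_top_iff]
    exact hc0 ▸ hc 0
  have hS : ∀ z, meromorphicOrderAt S z = ⊤ := by
    intro z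
    by_contra hz
    have hne : ∀ y, meromorphicOrderAt S y ≠ ⊤ := fun y =>
      MeromorphicOn.meromorphicOrderAt_ne_top_of_isPreconnected (U := Set.univ)
        (fun x _ => hm x) isPreconnected_univ (Set.mem_univ z) (Set.mem_univ y) hz
    rw [WithTop.add_eq_top] at htop
    exact htop.elim (hne _) (hne _)
  refine ext_of_lift fun w hw => ?_
  rw [analyticAt_eq_of_eventually_punctured (analyticAt_lift s hw)
    (meromorphicOrderAt_eq_top_iff.1 (hS w)), lift_of_off _ hw]
  rfl

/-! ### Decomposition of a representation of `G` into eigenspaces -/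

section Representation

variable {V : Type*} [AddCommGroup V] [Module ℂ V] (ρ : Representation ℂ G V)

lemma rep_mul_self (g : G) (v : V) : ρ g (ρ g v) = v := by
  have h : g * g = 1 := by
    revert g
    decide
  rw [← Module.End.mul_apply, ← map_mul, h, map_one, Module.End.one_apply]

lemma rep_comm (g g' : G) (v : V) : ρ g (ρ g' v) = ρ g' (ρ g v) := by
  rw [← Module.End.mul_apply, ← map_mul, mul_comm, map_mul, Module.End.mul_apply]

/-- Projection to an eigenspace by averaging over `G`. -/
lemma smul_average_mem_eigenspace (ε₁ ε₂ : ℤˣ) (v : V) :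
    (1 / 4 : ℂ) • (v + ((ε₁ : ℤ) : ℂ) • ρ g₁ v + ((ε₂ : ℤ) : ℂ) • ρ g₂ v +
      ((ε₁ : ℤ) : ℂ) • ((ε₂ : ℤ) : ℂ) • ρ g₁ (ρ g₂ v)) ∈ eigenspace ρ ε₁ ε₂ := by
  rcases Int.units_eq_one_or ε₁ with rfl | rfl <;> rcases Int.units_eq_one_or ε₂ with rfl | rfl <;>
    refine ⟨?_, ?_⟩ <;>
    simp only [map_smul, map_add, rep_comm ρ g₂ g₁, rep_mul_self] <;> push_cast <;> module

/-- Every vector is the sum of its four components in the eigenspaces. -/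
lemma exists_eigenspace_decomposition (v : V) : ∃ x ∈ eigenspace ρ 1 1,
    ∃ y ∈ eigenspace ρ (-1) (-1), ∃ z ∈ eigenspace ρ (-1) 1, ∃ w ∈ eigenspace ρ 1 (-1),
      v = x + y + z + w := by
  refine ⟨_, smul_average_mem_eigenspace ρ 1 1 v, _, smul_average_mem_eigenspace ρ (-1) (-1) v,
    _, smul_average_mem_eigenspace ρ (-1) 1 v, _, smul_average_mem_eigenspace ρ 1 (-1) v, ?_⟩
  push_cast
  module

lemma eq_zero_of_add_eigenvectors_eq_zero {x y z : V} (hx : x ∈ eigenspace ρ 1 1)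
    (hy : y ∈ eigenspace ρ (-1) (-1)) (hz : z ∈ eigenspace ρ (-1) 1) (h : x + y + z = 0) :
    x = 0 ∧ y = 0 ∧ z = 0 := by
  have h1 : ρ g₁ (x + y + z) = 0 := by rw [h, map_zero]
  have h2 : ρ g₂ (x + y + z) = 0 := by rw [h, map_zero]
  rw [map_add, map_add, hx.1, hy.1, hz.1] at h1
  rw [map_add, map_add, hx.2, hy.2, hz.2] at h2
  push_cast at h1 h2
  refine ⟨?_, ?_, ?_⟩
  · linear_combination (norm := module) (1 / 2 : ℂ) • h + (1 / 2 : ℂ) • h1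
  · linear_combination (norm := module) (1 / 2 : ℂ) • h - (1 / 2 : ℂ) • h2
  · linear_combination (norm := module) (1 / 2 : ℂ) • h2 - (1 / 2 : ℂ) • h1

end Representation

/-! ### A basis of eigensections -/

lemma neg_div4_le_of_nonneg {x : Torus P} {o : WithTop ℤ} (ho : 0 ≤ o) :
    ((-div4 P x : ℤ) : WithTop ℤ) ≤ o := by
  refine le_trans ?_ ho
  have : -div4 P x ≤ 0 := neg_nonpos.2 (div4_nonneg x)
  exact_mod_cast this

/-- The Weierstrass function `℘` as a section. -/
def wpSection (P : PeriodPair) : H0 (div4 P) :=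
  sectionOf P.weierstrassP (fun z l hl => P.weierstrassP_add_coe z ⟨l, hl⟩)
    (fun z => by
      by_cases hz : z ∈ P.lattice
      · rw [P.order_weierstrassP z hz, proj_eq_zero_iff.2 hz, div4_zero]
        rfl
      · exact neg_div4_le_of_nonneg (P.analyticOnNhd_weierstrassP z hz).meromorphicOrderAt_nonneg)
    (fun z => P.meromorphic_weierstrassP z)
    (fun z hz => P.analyticOnNhd_weierstrassP z (div4_proj_eq_zero_iff.1 hz).1)

lemma lift_wpSection_eventuallyEq (z : ℂ) : lift (wpSection P).1 =ᶠ[𝓝[≠] z] P.weierstrassP :=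
  lift_sectionOf_eventuallyEq z

lemma div4_proj_neg (w : ℂ) : div4 P (proj P (-w)) = div4 P (proj P w) := by
  have v1 : (1 : ZMod 2).val = 1 := rfl
  simpa [act, v1] using div4_act P (0, 1) (proj P w)

lemma rep_g₂_wpSection : rep₁ P g₂ (wpSection P) = wpSection P := by
  refine ext_of_lift fun w hw => ?_
  rw [lift_rep_g₂, wpSection, lift_sectionOf hw, lift_sectionOf ((div4_proj_neg w).trans hw),
    P.weierstrassP_neg]

lemma rep_g₂_rep_g₁_wpSection : rep₁ P g₂ (rep₁ P g₁ (wpSection P)) = rep₁ P g₁ (wpSection P) := by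
  rw [rep_comm, rep_g₂_wpSection]

lemma wpSection_add_mem : wpSection P + rep₁ P g₁ (wpSection P) ∈ V₁ P 1 1 := by
  refine ⟨?_, ?_⟩
  · rw [map_add, rep_mul_self]
    push_cast
    module
  · rw [map_add, rep_g₂_wpSection, rep_g₂_rep_g₁_wpSection]
    push_cast
    module

lemma wpSection_sub_mem : wpSection P - rep₁ P g₁ (wpSection P) ∈ V₁ P (-1) 1 := by
  refine ⟨?_, ?_⟩
  · rw [map_sub, rep_mul_self]
    push_cast
    module
  · rw [map_sub, rep_g₂_wpSection, rep_g₂_rep_g₁_wpSection]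
    push_cast
    module

/-- `℘(z) + c ℘(z + e/2)` has a pole at `o`, coming from its first term. -/
lemma order_lift_wpSection_add_smul_neg (c : ℂ) :
    meromorphicOrderAt (lift (wpSection P + c • rep₁ P g₁ (wpSection P)).1) 0 < 0 := by
  have e : lift (wpSection P + c • rep₁ P g₁ (wpSection P)).1 =ᶠ[𝓝[≠] 0]
      P.weierstrassP + fun w => c * P.weierstrassP (w + P.ω₁ / 2) := by
    have ht : Tendsto (fun w => w + P.ω₁ / 2) (𝓝[≠] 0) (𝓝[≠] (0 + P.ω₁ / 2)) := by
      simpa using tendsto_sub_nhdsNE 0 (-(P.ω₁ / 2))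
    filter_upwards [lift_wpSection_eventuallyEq 0, ht.eventually (lift_wpSection_eventuallyEq _)]
      with w h1 h2
    rw [Submodule.coe_add, lift_add, Submodule.coe_smul, lift_smul, lift_rep_g₁, h1, h2,
      Pi.add_apply]
  have han : AnalyticAt ℂ (fun w => c * P.weierstrassP (w + P.ω₁ / 2)) 0 := by
    refine analyticAt_const.mul (AnalyticAt.fun_comp (g := P.weierstrassP) ?_ (by fun_prop))
    rw [zero_add]
    exact P.analyticOnNhd_weierstrassP _ P.ω₁_div_two_notMem_lattice
  have h2 : meromorphicOrderAt P.weierstrassP 0 = -2 := P.order_weierstrassP 0 (zero_mem _)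
  have hlt : (-2 : WithTop ℤ) < 0 := by decide
  rw [meromorphicOrderAt_congr e, meromorphicOrderAt_add_eq_left_of_lt han.meromorphicAt, h2]
  · exact hlt
  · rw [h2]
    exact hlt.trans_le han.meromorphicOrderAt_nonneg

/-- The function `℘'(z) (℘(z - e/2) - ℘(e/2))`. The double zero of the second factor at `o`
reduces the triple pole of `℘'` to a simple one. -/
def oddFun (P : PeriodPair) (z : ℂ) : ℂ :=
  P.derivWeierstrassP z * (P.weierstrassP (z - P.ω₁ / 2) - P.weierstrassP (P.ω₁ / 2))

lemma meromorphicAt_wp_shift (z : ℂ) : MeromorphicAt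
    (fun z => P.weierstrassP (z - P.ω₁ / 2) - P.weierstrassP (P.ω₁ / 2)) z :=
  MeromorphicAt.sub ((P.meromorphic_weierstrassP (z - P.ω₁ / 2)).comp_analyticAt
    (f := P.weierstrassP) (g := fun w => w - P.ω₁ / 2) (by fun_prop)) (.const _ z)

lemma meromorphicAt_oddFun (z : ℂ) : MeromorphicAt (oddFun P) z :=
  (P.meromorphic_derivWeierstrassP z).mul (meromorphicAt_wp_shift z)

lemma order_oddFun (z : ℂ) : meromorphicOrderAt (oddFun P) z =
    meromorphicOrderAt P.derivWeierstrassP z + meromorphicOrderAt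
      (fun z => P.weierstrassP (z - P.ω₁ / 2) - P.weierstrassP (P.ω₁ / 2)) z :=
  meromorphicOrderAt_mul (P.meromorphic_derivWeierstrassP z) (meromorphicAt_wp_shift z)

lemma analyticAt_wp_shift {z : ℂ} (hz : z - P.ω₁ / 2 ∉ P.lattice) : AnalyticAt ℂ
    (fun z => P.weierstrassP (z - P.ω₁ / 2) - P.weierstrassP (P.ω₁ / 2)) z :=
  ((P.analyticOnNhd_weierstrassP _ hz).fun_comp (g := P.weierstrassP)
    (f := fun w => w - P.ω₁ / 2) (by fun_prop)).sub analyticAt_const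

lemma analyticAt_oddFun {z : ℂ} (hz : z ∉ P.lattice) (hz' : z - P.ω₁ / 2 ∉ P.lattice) :
    AnalyticAt ℂ (oddFun P) z :=
  (P.analyticOnNhd_derivWeierstrassP z hz).mul (analyticAt_wp_shift hz')

lemma neg_half_notMem : (0 : ℂ) - P.ω₁ / 2 ∉ P.lattice := by
  rw [zero_sub, neg_mem_iff]
  exact P.ω₁_div_two_notMem_lattice

lemma oddFun_add_lattice (z : ℂ) {l : ℂ} (hl : l ∈ P.lattice) :
    oddFun P (z + l) = oddFun P z := by
  rw [oddFun, oddFun, P.derivWeierstrassP_add_coe z ⟨l, hl⟩,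
    show z + l - P.ω₁ / 2 = z - P.ω₁ / 2 + l by ring, P.weierstrassP_add_coe _ ⟨l, hl⟩]

lemma wp_reflect_half (w : ℂ) :
    P.weierstrassP (-w - P.ω₁ / 2) = P.weierstrassP (w - P.ω₁ / 2) := by
  rw [← P.weierstrassP_neg, show -(-w - P.ω₁ / 2) = w - P.ω₁ / 2 + P.ω₁ by ring]
  exact P.weierstrassP_add_coe _ ⟨_, P.ω₁_mem_lattice⟩

lemma oddFun_neg (w : ℂ) : oddFun P (-w) = -oddFun P w := by
  rw [oddFun, oddFun, P.derivWeierstrassP_neg, wp_reflect_half]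
  ring

lemma order_derivWeierstrassP_zero :
    meromorphicOrderAt P.derivWeierstrassP 0 = ((-3 : ℤ) : WithTop ℤ) := by
  rw [← P.deriv_weierstrassP]
  exact meromorphicOrderAt_deriv_eq_sub_one (n := -2) (by norm_num)
    (P.order_weierstrassP 0 (zero_mem _))

lemma order_wp_shift_half : meromorphicOrderAt
    (fun z => P.weierstrassP (z - P.ω₁ / 2) - P.weierstrassP (P.ω₁ / 2)) (P.ω₁ / 2) = -2 := by
  have h := meromorphicOrderAt_comp_sub_const_eq_meromorphicOrderAt (x := P.ω₁ / 2)
    (c := P.ω₁ / 2) (f := P.weierstrassP)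
  have h' : meromorphicOrderAt (fun z => P.weierstrassP (z - P.ω₁ / 2)) (P.ω₁ / 2) = -2 := by
    refine h.trans ?_
    rw [sub_self]
    exact P.order_weierstrassP 0 (zero_mem _)
  have e : (fun z => P.weierstrassP (z - P.ω₁ / 2) - P.weierstrassP (P.ω₁ / 2)) =
      (fun z => P.weierstrassP (z - P.ω₁ / 2)) + fun _ => -P.weierstrassP (P.ω₁ / 2) := by
    funext z
    exact sub_eq_add_neg _ _
  rw [e, meromorphicOrderAt_add_eq_left_of_lt (.const _ _), h']
  rw [h']
  exact lt_of_lt_of_le (by decide) (analyticAt_const).meromorphicOrderAt_nonneg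

lemma two_le_order_wp_shift_zero : (2 : WithTop ℤ) ≤ meromorphicOrderAt
    (fun z => P.weierstrassP (z - P.ω₁ / 2) - P.weierstrassP (P.ω₁ / 2)) 0 := by
  have han := analyticAt_wp_shift (P := P) neg_half_notMem
  have hpos : 0 < meromorphicOrderAt
      (fun z => P.weierstrassP (z - P.ω₁ / 2) - P.weierstrassP (P.ω₁ / 2)) 0 := by
    refine (tendsto_zero_iff_meromorphicOrderAt_pos (meromorphicAt_wp_shift 0)).1 ?_
    have := han.continuousAt.tendsto
    simp only [zero_sub, P.weierstrassP_neg, sub_self] at this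
    exact this.mono_left nhdsWithin_le_nhds
  cases h : meromorphicOrderAt
      (fun z => P.weierstrassP (z - P.ω₁ / 2) - P.weierstrassP (P.ω₁ / 2)) 0 with
  | top => exact le_top
  | coe m =>
    have hpar := symm_sign_eq_of_order (ε := 1) (meromorphicAt_wp_shift 0)
      (fun w => by rw [mul_zero, zero_sub, wp_reflect_half, one_mul]) h
    rw [h] at hpos
    have h0 : 0 < m := by exact_mod_cast hpos
    have h1 : m ≠ 1 := by
      rintro rfl
      norm_num at hpar
    exact WithTop.coe_le_coe.2 (show 2 ≤ m by omega)

/-- `oddFun` as a section. -/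
def oddSection (P : PeriodPair) : H0 (div4 P) :=
  sectionOf (oddFun P) (fun z l hl => oddFun_add_lattice z hl)
    (fun z => by
      by_cases hz : z ∈ P.lattice
      · rw [← zero_add z, meromorphicOrderAt_add_of_periodic fun w => oddFun_add_lattice w hz,
          zero_add, proj_eq_zero_iff.2 hz, div4_zero, order_oddFun, order_derivWeierstrassP_zero]
        exact le_trans (by decide) (add_le_add_right two_le_order_wp_shift_zero _)
      · by_cases hz' : z - P.ω₁ / 2 ∈ P.lattice
        · rw [proj_eq_half_iff.2 hz', div4_half, ← add_sub_cancel (P.ω₁ / 2) z,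
            meromorphicOrderAt_add_of_periodic fun w => oddFun_add_lattice w hz', order_oddFun,
            order_wp_shift_half]
          exact le_add_of_nonneg_left (P.analyticOnNhd_derivWeierstrassP _
            P.ω₁_div_two_notMem_lattice).meromorphicOrderAt_nonneg
        · exact neg_div4_le_of_nonneg (analyticAt_oddFun hz hz').meromorphicOrderAt_nonneg)
    meromorphicAt_oddFun
    (fun z hz => analyticAt_oddFun (div4_proj_eq_zero_iff.1 hz).1 (div4_proj_eq_zero_iff.1 hz).2)

lemma lift_oddSection {w : ℂ} (hw : div4 P (proj P w) = 0) :
    lift (oddSection P).1 w = oddFun P w := lift_sectionOf hw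

lemma lift_oddSection_eventuallyEq (z : ℂ) : lift (oddSection P).1 =ᶠ[𝓝[≠] z] oddFun P :=
  lift_sectionOf_eventuallyEq z

lemma rep_g₂_oddSection : rep₁ P g₂ (oddSection P) = -oddSection P := by
  rw [← neg_one_smul ℂ (oddSection P)]
  refine ext_of_lift fun w hw => ?_
  rw [lift_rep_g₂, Submodule.coe_smul, lift_smul, lift_oddSection hw,
    lift_oddSection ((div4_proj_neg w).trans hw), oddFun_neg, neg_one_mul]

/-- Invariance of `oddSection` up to sign under translation by `e/2` comes for free: the sum of
`oddSection` and its translate is odd and invariant, hence `0`. -/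
lemma oddSection_mem : oddSection P ∈ V₁ P (-1) (-1) := by
  have h : oddSection P + rep₁ P g₁ (oddSection P) ∈ V₁ P 1 (-1) := by
    refine ⟨?_, ?_⟩
    · rw [map_add, rep_mul_self]
      push_cast
      module
    · rw [map_add, rep_comm, rep_g₂_oddSection, map_neg]
      push_cast
      module
  have h0 := eq_zero_of_mem_V₁_one_neg_one h
  refine ⟨?_, ?_⟩
  · rw [eq_neg_of_add_eq_zero_right h0]
    push_cast
    module
  · rw [rep_g₂_oddSection]
    push_cast
    module

lemma oddSection_order_ne_top : meromorphicOrderAt (lift (oddSection P).1) 0 ≠ ⊤ := by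
  rw [meromorphicOrderAt_congr (lift_oddSection_eventuallyEq 0), order_oddFun,
    order_derivWeierstrassP_zero, Ne, WithTop.add_eq_top, not_or]
  refine ⟨WithTop.coe_ne_top, ?_⟩
  refine MeromorphicOn.meromorphicOrderAt_ne_top_of_isPreconnected (U := Set.univ)
    (x := P.ω₁ / 2) (fun x _ => meromorphicAt_wp_shift x) isPreconnected_univ (Set.mem_univ _)
    (Set.mem_univ _) ?_
  rw [order_wp_shift_half]
  decide

lemma order_oddSection_neg : meromorphicOrderAt (lift (oddSection P).1) 0 < 0 := by
  by_contra! h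
  obtain ⟨c, hc⟩ := exists_eq_smul_oneSection_of_mem oddSection_mem h
  have h0 : oddSection P = 0 := by
    rw [hc]
    exact smul_oneSection_eq_zero (hc ▸ oddSection_mem) (Or.inl rfl)
  refine oddSection_order_ne_top (P := P) ?_
  rw [meromorphicOrderAt_eq_top_iff, h0]
  filter_upwards [eventually_div4_eq_zero 0] with w hw
  rw [lift_of_off _ hw]
  rfl

/-- A section with a pole at `o` is linearly independent from the constants. -/
lemma eq_zero_of_smul_add_smul_oneSection {t : H0 (div4 P)}
    (ht : meromorphicOrderAt (lift t.1) 0 < 0) {a c : ℂ} (h : c • oneSection P + a • t = 0) :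
    c = 0 ∧ a = 0 := by
  have hE : ∀ᶠ w in 𝓝[≠] (0 : ℂ), c + a * lift t.1 w = 0 := by
    filter_upwards [eventually_div4_eq_zero 0] with w hw
    have := congrArg (fun s : H0 (div4 P) => lift s.1 w) h
    beta_reduce at this
    rw [Submodule.coe_add, lift_add, Submodule.coe_smul, lift_smul, Submodule.coe_smul, lift_smul,
      lift_oneSection hw, mul_one, lift_of_off (0 : H0 (div4 P)).1 hw] at this
    exact this
  have ha : a = 0 := by
    by_contra ha
    have e : (fun w => a * lift t.1 w) =ᶠ[𝓝[≠] 0] fun _ => -c :=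
      hE.mono fun w hw => by linear_combination hw
    rw [← meromorphicOrderAt_const_mul ha, meromorphicOrderAt_congr e] at ht
    exact absurd ht (not_lt.2 (analyticAt_const).meromorphicOrderAt_nonneg)
  refine ⟨?_, ha⟩
  obtain ⟨w, hw⟩ := hE.exists
  simpa [ha] using hw

/-- The four eigensections `1`, `℘(z) + ℘(z + e/2)`, `oddSection` and `℘(z) - ℘(z + e/2)`. -/
def eigensection (P : PeriodPair) : Fin 4 → H0 (div4 P) :=
  ![oneSection P, wpSection P + rep₁ P g₁ (wpSection P), oddSection P,
    wpSection P - rep₁ P g₁ (wpSection P)]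

/-- The signs by which `g₁` and `g₂` act on the members of `eigensection` under `rep₁`. -/
def eigensign : Fin 4 → ℤˣ × ℤˣ := ![(1, 1), (1, 1), (-1, -1), (-1, 1)]

lemma eigensection_mem (i : Fin 4) :
    eigensection P i ∈ V₁ P (eigensign i).1 (eigensign i).2 := by
  fin_cases i
  exacts [oneSection_mem, wpSection_add_mem, oddSection_mem, wpSection_sub_mem]

lemma order_wpSection_add_neg :
    meromorphicOrderAt (lift (wpSection P + rep₁ P g₁ (wpSection P)).1) 0 < 0 := by
  have := order_lift_wpSection_add_smul_neg (P := P) 1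
  rwa [one_smul] at this

lemma order_wpSection_sub_neg :
    meromorphicOrderAt (lift (wpSection P - rep₁ P g₁ (wpSection P)).1) 0 < 0 := by
  have e : wpSection P - rep₁ P g₁ (wpSection P) =
      wpSection P + (-1 : ℂ) • rep₁ P g₁ (wpSection P) := by module
  rw [e]
  exact order_lift_wpSection_add_smul_neg (-1)

lemma linearIndependent_eigensection : LinearIndependent ℂ (eigensection P) := by
  rw [Fintype.linearIndependent_iff]
  intro a ha
  simp only [Fin.sum_univ_four, eigensection, Matrix.cons_val] at ha
  obtain ⟨h1, h2, h3⟩ := eq_zero_of_add_eigenvectors_eq_zero (rep₁ P)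
    (add_mem (Submodule.smul_mem _ (a 0) oneSection_mem)
      (Submodule.smul_mem _ (a 1) wpSection_add_mem))
    (Submodule.smul_mem _ (a 2) oddSection_mem) (Submodule.smul_mem _ (a 3) wpSection_sub_mem) ha
  obtain ⟨h0, h1⟩ := eq_zero_of_smul_add_smul_oneSection order_wpSection_add_neg h1
  have h2 := (eq_zero_of_smul_add_smul_oneSection (c := 0) order_oddSection_neg
    (by rw [h2, zero_smul, zero_add])).2
  have h3 := (eq_zero_of_smul_add_smul_oneSection (c := 0) order_wpSection_sub_neg
    (by rw [h3, zero_smul, zero_add])).2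
  intro i
  fin_cases i
  exacts [h0, h1, h2, h3]

lemma span_eigensection : ⊤ ≤ Submodule.span ℂ (Set.range (eigensection P)) := by
  rintro s -
  have hmem : ∀ i, eigensection P i ∈ Submodule.span ℂ (Set.range (eigensection P)) := fun i =>
    Submodule.subset_span (Set.mem_range_self i)
  obtain ⟨x, hx, y, hy, z, hz, w, hw, rfl⟩ := exists_eigenspace_decomposition (rep₁ P) s
  obtain ⟨a, c, rfl⟩ :=
    exists_eq_smul_add_smul_oneSection hx wpSection_add_mem order_wpSection_add_neg
  obtain ⟨a', c', rfl⟩ := exists_eq_smul_add_smul_oneSection hy oddSection_mem order_oddSection_neg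
  obtain ⟨a'', c'', rfl⟩ :=
    exists_eq_smul_add_smul_oneSection hz wpSection_sub_mem order_wpSection_sub_neg
  rw [eq_zero_of_mem_V₁_one_neg_one hw, add_zero]
  refine add_mem (add_mem ?_ ?_) ?_ <;> refine add_mem (Submodule.smul_mem _ _ ?_)
    (Submodule.smul_mem _ _ (hmem 0))
  exacts [hmem 1, hmem 2, hmem 3]

/-- `eigensection` as a basis of `H⁰(E, 𝒪(2[o] + 2[e/2]))`. -/
def eigenbasis (P : PeriodPair) : Module.Basis (Fin 4) ℂ (H0 (div4 P)) :=
  Module.Basis.mk linearIndependent_eigensection span_eigensection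

lemma eigenbasis_mem (i : Fin 4) : eigenbasis P i ∈ V₁ P (eigensign i).1 (eigensign i).2 := by
  rw [eigenbasis, Module.Basis.mk_apply]
  exact eigensection_mem i

/-! ### The canonical map is an isomorphism -/

variable {Q : PeriodPair}

lemma kunneth_tmul_apply (s : H0 (div4 P)) (t : H0 (div4 Q)) (x : Off (div4 P))
    (y : Off (div4 Q)) : (kunneth P Q (s ⊗ₜ t)).1 (x, y) = s.1 x * t.1 y := rfl

/-- Local sections form a module over the holomorphic functions. -/
lemma isSectionAt_sum_smul {ι : Type*} (I : Finset ι) {D : Divisor P} {z : ℂ} (c : ι → ℂ → ℂ)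
    (s : ι → Off D → ℂ) (hc : ∀ i, AnalyticAt ℂ (c i) z) (hs : ∀ i, IsSectionAt D (s i) z)
    {f : Off D → ℂ} (hf : ∀ᶠ w in 𝓝 z, ∀ hw : D (proj P w) = 0,
      f ⟨proj P w, hw⟩ = ∑ i ∈ I, c i w * s i ⟨proj P w, hw⟩) : IsSectionAt D f z := by
  choose h hh e using hs
  refine ⟨fun w => ∑ i ∈ I, c i w * h i w,
    Finset.analyticAt_fun_sum _ fun i _ => (hc i).mul (hh i), ?_⟩
  filter_upwards [hf, (Filter.eventually_all_finset I).2 fun i _ => e i] with w h1 h2 hw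
  rw [h1 hw, Finset.mul_sum]
  refine Finset.sum_congr rfl fun i hi => ?_
  rw [h2 i hi hw]
  ring

/-- The restriction of a section on the product to a vertical fibre is a section. -/
lemma slice_left_mem (F : H44 P Q) (x : Off (div4 P)) : (fun y => F.1 (x, y)) ∈ H0 (div4 Q) := by
  intro z₂
  obtain ⟨x, hx⟩ := x
  obtain ⟨z₁, rfl⟩ := P.lattice.mkQ_surjective x
  obtain ⟨n, h, s, t, hh, -, ht, e⟩ := F.2 (z₁, z₂)
  have hι : ContinuousAt (fun w : ℂ => (z₁, w)) z₂ := by fun_prop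
  refine isSectionAt_sum_smul Finset.univ (fun k w => h k (z₁, w) * s k ⟨proj P z₁, hx⟩) t
    (fun k => ?_) ht ?_
  · exact (AnalyticAt.fun_comp (g := h k) (f := fun w : ℂ => (z₁, w)) (hh k)
      (analyticAt_const.prod analyticAt_id)).mul analyticAt_const
  · filter_upwards [hι.eventually e] with w hw h2
    refine (hw hx h2).trans (Finset.sum_congr rfl fun k _ => ?_)
    ring

/-- The restriction of a section on the product to a horizontal fibre is a section. -/
lemma slice_right_mem (F : H44 P Q) (y : Off (div4 Q)) : (fun x => F.1 (x, y)) ∈ H0 (div4 P) := by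
  intro z₁
  obtain ⟨y, hy⟩ := y
  obtain ⟨z₂, rfl⟩ := Q.lattice.mkQ_surjective y
  obtain ⟨n, h, s, t, hh, hs, -, e⟩ := F.2 (z₁, z₂)
  have hι : ContinuousAt (fun w : ℂ => (w, z₂)) z₁ := by fun_prop
  refine isSectionAt_sum_smul Finset.univ (fun k w => h k (w, z₂) * t k ⟨proj Q z₂, hy⟩) s
    (fun k => ?_) hs ?_
  · exact (AnalyticAt.fun_comp (g := h k) (f := fun w : ℂ => (w, z₂)) (hh k)
      (analyticAt_id.prod analyticAt_const)).mul analyticAt_const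
  · filter_upwards [hι.eventually e] with w hw h2
    refine (hw h2 hy).trans (Finset.sum_congr rfl fun k _ => ?_)
    ring

lemma injective_of_apply_eq_zero {V W N : Type*} [AddCommGroup V] [Module ℂ V] [AddCommGroup W]
    [Module ℂ W] [AddCommGroup N] [Module ℂ N] (f : V ⊗[ℂ] W →ₗ[ℂ] N)
    (h : ∀ τ, f τ = 0 → τ = 0) : Function.Injective f :=
  (injective_iff_map_eq_zero f).2 h

lemma kunneth_injective : Function.Injective (kunneth P Q) := by
  refine injective_of_apply_eq_zero (kunneth P Q) fun τ hτ => ?_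
  let b := (eigenbasis P).tensorProduct (eigenbasis Q)
  have hexp : τ = ∑ i, ∑ j, b.repr τ (i, j) • (eigenbasis P i ⊗ₜ[ℂ] eigenbasis Q j) := by
    conv_lhs => rw [← b.sum_repr τ, Fintype.sum_prod_type]
    simp [b]
  have hval : ∀ x y, ∑ i, ∑ j, b.repr τ (i, j) * ((eigenbasis P i).1 x * (eigenbasis Q j).1 y)
      = 0 := by
    intro x y
    have := congrArg (fun F : H44 P Q => F.1 (x, y)) hτ
    rw [hexp] at this
    simpa [map_sum, kunneth_tmul_apply] using this
  have hP := Fintype.linearIndependent_iff.1 (eigenbasis P).linearIndependent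
  have hQ := Fintype.linearIndependent_iff.1 (eigenbasis Q).linearIndependent
  have hzero : ∀ i j, b.repr τ (i, j) = 0 := by
    have h1 : ∀ y i, ∑ j, b.repr τ (i, j) * (eigenbasis Q j).1 y = 0 := by
      intro y
      refine hP _ (Subtype.ext (funext fun x => ?_))
      have := hval x y
      simp only [Submodule.coe_sum, Submodule.coe_smul, Finset.sum_apply, Pi.smul_apply,
        smul_eq_mul, Finset.sum_mul]
      refine Eq.trans (Finset.sum_congr rfl fun i _ => Finset.sum_congr rfl fun j _ => ?_) this
      ring
    intro i
    refine hQ _ (Subtype.ext (funext fun y => ?_))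
    simpa [Submodule.coe_sum, Submodule.coe_smul, Finset.sum_apply] using h1 y i
  rw [hexp]
  simp [hzero]

/-- On a finite-dimensional space of functions, every linear form is a linear combination of
evaluations at points. -/
lemma mem_span_evaluations {Y : Type*} (W : Submodule ℂ (Y → ℂ)) [FiniteDimensional ℂ W]
    (φ : Module.Dual ℂ W) :
    φ ∈ Submodule.span ℂ (Set.range fun y : Y =>
      LinearMap.proj (R := ℂ) (φ := fun _ : Y => ℂ) y ∘ₗ W.subtype) := by
  set Φ := Submodule.span ℂ
    (Set.range fun y : Y => LinearMap.proj (R := ℂ) (φ := fun _ : Y => ℂ) y ∘ₗ W.subtype)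
  have h : Φ.dualCoannihilator = ⊥ := by
    refine (Submodule.eq_bot_iff _).2 fun w hw => Subtype.ext (funext fun y => ?_)
    exact (Submodule.mem_dualCoannihilator w).1 hw _ (Submodule.subset_span ⟨y, rfl⟩)
  have h2 := Subspace.dualCoannihilator_dualAnnihilator_eq (W := Φ)
  rw [h, Submodule.dualAnnihilator_bot] at h2
  exact h2 ▸ Submodule.mem_top

/-- Expand the restrictions `F(x, ·)` in a basis of `H⁰(E₂, L₂)`. The coefficients, as functions
of `x`, are linear combinations of restrictions `F(·, y)`, hence sections. -/
lemma kunneth_surjective : Function.Surjective (kunneth P Q) := by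
  intro F
  have : FiniteDimensional ℂ (H0 (div4 Q)) := (eigenbasis Q).finiteDimensional_of_finite
  have hcoeff : ∀ φ : Module.Dual ℂ (H0 (div4 Q)),
      (fun x => φ ⟨fun y => F.1 (x, y), slice_left_mem F x⟩) ∈ H0 (div4 P) := by
    intro φ
    induction mem_span_evaluations (H0 (div4 Q)) φ using Submodule.span_induction with
    | mem φ h =>
      obtain ⟨y, rfl⟩ := h
      exact slice_right_mem F y
    | zero => exact (H0 (div4 P)).zero_mem
    | add φ ψ _ _ h h' => exact (H0 (div4 P)).add_mem h h'
    | smul c φ _ h => exact (H0 (div4 P)).smul_mem c h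
  refine ⟨∑ j, (⟨_, hcoeff ((eigenbasis Q).coord j)⟩ : H0 (div4 P)) ⊗ₜ eigenbasis Q j, ?_⟩
  refine Subtype.ext (funext fun p => ?_)
  obtain ⟨x, y⟩ := p
  have h := congrFun (congrArg Subtype.val
    ((eigenbasis Q).sum_repr ⟨fun y => F.1 (x, y), slice_left_mem F x⟩)) y
  rw [Submodule.coe_sum, Finset.sum_apply] at h
  rw [map_sum, Submodule.coe_sum, Finset.sum_apply]
  exact h

/-! ### Eigenspaces of the representation on the product -/

section Representation

variable {V : Type*} [AddCommGroup V] [Module ℂ V] (ρ : Representation ℂ G V)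

lemma sign_injective {ε ε' : ℤˣ} (h : ((ε : ℤ) : ℂ) = ((ε' : ℤ) : ℂ)) : ε = ε' :=
  Units.ext (by exact_mod_cast h)

/-- An eigenspace is spanned by the members with the corresponding signs of any basis of
eigenvectors. -/
lemma eigenspace_eq_span {ι : Type*} (b : Module.Basis ι ℂ V) (χ : ι → ℤˣ × ℤˣ)
    (hb : ∀ i, b i ∈ eigenspace ρ (χ i).1 (χ i).2) (ε : ℤˣ × ℤˣ) :
    eigenspace ρ ε.1 ε.2 = Submodule.span ℂ (b '' {i | χ i = ε}) := by
  refine le_antisymm (fun v hv => ?_) (Submodule.span_le.2 ?_)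
  · rw [b.mem_span_image]
    intro i hi
    have hi : b.repr v i ≠ 0 := by simpa using hi
    have h1 : ∀ v, b.repr (ρ g₁ v) i = (((χ i).1 : ℤ) : ℂ) * b.repr v i := by
      have : b.coord i ∘ₗ ρ g₁ = (((χ i).1 : ℤ) : ℂ) • b.coord i := b.ext fun j => by
        by_cases hij : j = i
        · subst hij; simp [(hb j).1]
        · simp [(hb j).1, hij]
      exact fun v => LinearMap.congr_fun this v
    have h2 : ∀ v, b.repr (ρ g₂ v) i = (((χ i).2 : ℤ) : ℂ) * b.repr v i := by
      have : b.coord i ∘ₗ ρ g₂ = (((χ i).2 : ℤ) : ℂ) • b.coord i := b.ext fun j => by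
        by_cases hij : j = i
        · subst hij; simp [(hb j).2]
        · simp [(hb j).2, hij]
      exact fun v => LinearMap.congr_fun this v
    have e1 := h1 v
    have e2 := h2 v
    rw [hv.1, map_smul, Finsupp.smul_apply, smul_eq_mul] at e1
    rw [hv.2, map_smul, Finsupp.smul_apply, smul_eq_mul] at e2
    exact Prod.ext (sign_injective (mul_right_cancel₀ hi e1)).symm
      (sign_injective (mul_right_cancel₀ hi e2)).symm
  · rintro _ ⟨i, rfl, rfl⟩
    exact hb i

lemma finrank_eigenspace {ι : Type*} [Fintype ι] [DecidableEq ι] (b : Module.Basis ι ℂ V)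
    (χ : ι → ℤˣ × ℤˣ) (hb : ∀ i, b i ∈ eigenspace ρ (χ i).1 (χ i).2) (ε : ℤˣ × ℤˣ) :
    Module.finrank ℂ (eigenspace ρ ε.1 ε.2) = Fintype.card {i // χ i = ε} := by
  rw [eigenspace_eq_span ρ b χ hb ε, Set.image_eq_range]
  exact finrank_span_eq_card (b.linearIndependent.comp _ Subtype.val_injective)

lemma invariants_eq_eigenspace : ρ.invariants = eigenspace ρ 1 1 := by
  ext v
  rw [Representation.mem_invariants]
  refine ⟨fun h => ⟨by simp [h g₁], by simp [h g₂]⟩, fun h g => ?_⟩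
  have h1 : ρ g₁ v = v := by simpa using h.1
  have h2 : ρ g₂ v = v := by simpa using h.2
  have hg : g = 1 ∨ g = g₁ ∨ g = g₂ ∨ g = g₁ * g₂ := by
    revert g
    decide
  rcases hg with rfl | rfl | rfl | rfl
  · simp
  · exact h1
  · exact h2
  · rw [map_mul, Module.End.mul_apply, h2, h1]

end Representation

lemma V₂_eq (ε₁ ε₂ : ℤˣ) : V₂ Q ε₁ ε₂ = V₁ Q ε₂ ε₁ := by
  ext s
  exact and_comm

lemma rep44_kunneth_tmul (g : G) (s : H0 (div4 P)) (t : H0 (div4 Q)) :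
    rep44 P Q g (kunneth P Q (s ⊗ₜ t)) = kunneth P Q (rep₁ P g s ⊗ₜ rep₂ Q g t) := rfl

lemma kunneth_tmul_mem {s : H0 (div4 P)} {t : H0 (div4 Q)} {ε₁ ε₂ δ₁ δ₂ : ℤˣ}
    (hs : s ∈ V₁ P ε₁ ε₂) (ht : t ∈ V₂ Q δ₁ δ₂) :
    kunneth P Q (s ⊗ₜ t) ∈ eigenspace (rep44 P Q) (ε₁ * δ₁) (ε₂ * δ₂) := by
  refine ⟨?_, ?_⟩
  · rw [rep44_kunneth_tmul, hs.1, ht.1, TensorProduct.smul_tmul_smul, map_smul]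
    push_cast
    rfl
  · rw [rep44_kunneth_tmul, hs.2, ht.2, TensorProduct.smul_tmul_smul, map_smul]
    push_cast
    rfl

/-- The products of eigensections, as a basis of the space of sections on the product. -/
def eigenbasis44 (P Q : PeriodPair) : Module.Basis (Fin 4 × Fin 4) ℂ (H44 P Q) :=
  ((eigenbasis P).tensorProduct (eigenbasis Q)).map
    (LinearEquiv.ofBijective (kunneth P Q) ⟨kunneth_injective, kunneth_surjective⟩)

lemma eigenbasis44_apply (i j : Fin 4) :
    eigenbasis44 P Q (i, j) = kunneth P Q (eigenbasis P i ⊗ₜ eigenbasis Q j) := by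
  rw [eigenbasis44, Module.Basis.map_apply, Module.Basis.tensorProduct_apply]
  rfl

/-- The signs by which `g₁` and `g₂` act on the members of `eigenbasis44`. On the second factor
the two generators change roles, whence the swap. -/
def eigensign44 (k : Fin 4 × Fin 4) : ℤˣ × ℤˣ := eigensign k.1 * (eigensign k.2).swap

lemma eigenbasis44_mem (k : Fin 4 × Fin 4) :
    eigenbasis44 P Q k ∈ eigenspace (rep44 P Q) (eigensign44 k).1 (eigensign44 k).2 := by
  obtain ⟨i, j⟩ := k
  rw [eigenbasis44_apply]
  exact kunneth_tmul_mem (eigenbasis_mem i) (V₂_eq (Q := Q) _ _ ▸ eigenbasis_mem j)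

lemma finrank_V₁ (ε : ℤˣ × ℤˣ) :
    Module.finrank ℂ (V₁ P ε.1 ε.2) = Fintype.card {i // eigensign i = ε} :=
  finrank_eigenspace (rep₁ P) (eigenbasis P) eigensign eigenbasis_mem ε

lemma finrank_eigenspace44 (ε : ℤˣ × ℤˣ) :
    Module.finrank ℂ (eigenspace (rep44 P Q) ε.1 ε.2) = Fintype.card {k // eigensign44 k = ε} :=
  finrank_eigenspace (rep44 P Q) (eigenbasis44 P Q) eigensign44 eigenbasis44_mem ε

lemma range_kunnethOn_le {ε₁ ε₂ δ₁ δ₂ : ℤˣ} :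
    LinearMap.range (kunnethOn (V₁ P ε₁ ε₂) (V₂ Q δ₁ δ₂)) ≤
      eigenspace (rep44 P Q) (ε₁ * δ₁) (ε₂ * δ₂) := by
  rintro _ ⟨τ, rfl⟩
  induction τ using TensorProduct.induction_on with
  | zero => rw [map_zero]; exact zero_mem _
  | add a b ha hb => rw [map_add]; exact add_mem ha hb
  | tmul s t => exact kunneth_tmul_mem s.2 t.2

lemma mem_range_kunnethOn {A : Submodule ℂ (H0 (div4 P))} {B : Submodule ℂ (H0 (div4 Q))}
    {i j : Fin 4} (hi : eigenbasis P i ∈ A) (hj : eigenbasis Q j ∈ B) :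
    eigenbasis44 P Q (i, j) ∈ LinearMap.range (kunnethOn A B) :=
  ⟨(⟨_, hi⟩ : A) ⊗ₜ (⟨_, hj⟩ : B), (eigenbasis44_apply i j).symm⟩

section

variable {V W N : Type*} [AddCommGroup V] [Module ℂ V] [AddCommGroup W] [Module ℂ W]
  [AddCommGroup N] [Module ℂ N]

lemma injective_of_finrank_range [FiniteDimensional ℂ V] (f : V →ₗ[ℂ] N)
    (h : Module.finrank ℂ (LinearMap.range f) = Module.finrank ℂ V) : Function.Injective f := by
  have := f.finrank_range_add_finrank_ker
  rw [← LinearMap.ker_eq_bot, ← Submodule.finrank_eq_zero (R := ℂ)]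
  omega

variable [FiniteDimensional ℂ V] [FiniteDimensional ℂ W]

lemma injective_of_finrank_range_two {A A' : Submodule ℂ V} {B B' : Submodule ℂ W}
    (f : (A ⊗[ℂ] B) × (A' ⊗[ℂ] B') →ₗ[ℂ] N)
    (h : Module.finrank ℂ (LinearMap.range f) = Module.finrank ℂ A * Module.finrank ℂ B +
      Module.finrank ℂ A' * Module.finrank ℂ B') : Function.Injective f := by
  refine injective_of_finrank_range f ?_
  rw [h, Module.finrank_prod, Module.finrank_tensorProduct, Module.finrank_tensorProduct]

lemma injective_of_finrank_range_three {A A' A'' : Submodule ℂ V} {B B' B'' : Submodule ℂ W}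
    (f : (A ⊗[ℂ] B) × (A' ⊗[ℂ] B') × (A'' ⊗[ℂ] B'') →ₗ[ℂ] N)
    (h : Module.finrank ℂ (LinearMap.range f) = Module.finrank ℂ A * Module.finrank ℂ B +
      (Module.finrank ℂ A' * Module.finrank ℂ B' + Module.finrank ℂ A'' * Module.finrank ℂ B'')) :
    Function.Injective f := by
  refine injective_of_finrank_range f ?_
  rw [h, Module.finrank_prod, Module.finrank_prod, Module.finrank_tensorProduct,
    Module.finrank_tensorProduct, Module.finrank_tensorProduct]

lemma nonempty_equiv_of_finrank {A : Submodule ℂ V} {n : ℕ} (h : Module.finrank ℂ A = n) :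
    Nonempty (A ≃ₗ[ℂ] (Fin n → ℂ)) :=
  ⟨LinearEquiv.ofFinrankEq _ _ (by simp [h])⟩

end

end KeumNaie

end

open KeumNaie in
theorem mainTheorem7 (P Q : PeriodPair) :
    -- the `++` eigenspace is the space of `G`-invariant sections
    (rep44 P Q).invariants = eigenspace (rep44 P Q) 1 1 ∧
    -- 1) it is the direct sum of `V₁⁺⁺ ⊗ V₂⁺⁺` and `V₁⁻⁻ ⊗ V₂⁻⁻`, of dimension 5
    (Function.Injective
        ((kunnethOn (V₁ P 1 1) (V₂ Q 1 1)).coprod (kunnethOn (V₁ P (-1) (-1)) (V₂ Q (-1) (-1)))) ∧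
      LinearMap.range
        ((kunnethOn (V₁ P 1 1) (V₂ Q 1 1)).coprod (kunnethOn (V₁ P (-1) (-1)) (V₂ Q (-1) (-1))))
        = eigenspace (rep44 P Q) 1 1 ∧
      Nonempty (eigenspace (rep44 P Q) 1 1 ≃ₗ[ℂ] (Fin 5 → ℂ))) ∧
    -- 2) the `--` eigenspace is the direct sum of `V₁⁺⁺ ⊗ V₂⁻⁻`, `V₁⁻⁻ ⊗ V₂⁺⁺` and `V₁⁻⁺ ⊗ V₂⁺⁻`
    (Function.Injective
        ((kunnethOn (V₁ P 1 1) (V₂ Q (-1) (-1))).coprod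
          ((kunnethOn (V₁ P (-1) (-1)) (V₂ Q 1 1)).coprod
            (kunnethOn (V₁ P (-1) 1) (V₂ Q 1 (-1))))) ∧
      LinearMap.range
        ((kunnethOn (V₁ P 1 1) (V₂ Q (-1) (-1))).coprod
          ((kunnethOn (V₁ P (-1) (-1)) (V₂ Q 1 1)).coprod
            (kunnethOn (V₁ P (-1) 1) (V₂ Q 1 (-1)))))
        = eigenspace (rep44 P Q) (-1) (-1) ∧
      Nonempty (eigenspace (rep44 P Q) (-1) (-1) ≃ₗ[ℂ] (Fin 5 → ℂ))) := by
  have fP : FiniteDimensional ℂ (H0 (div4 P)) := (eigenbasis P).finiteDimensional_of_finite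
  have fQ : FiniteDimensional ℂ (H0 (div4 Q)) := (eigenbasis Q).finiteDimensional_of_finite
  have fPQ : FiniteDimensional ℂ (H44 P Q) := (eigenbasis44 P Q).finiteDimensional_of_finite
  have d1 : ∀ R : PeriodPair, Module.finrank ℂ (V₁ R 1 1) = 2 := fun R =>
    (finrank_V₁ (1, 1)).trans (by decide)
  have d2 : ∀ R : PeriodPair, Module.finrank ℂ (V₁ R (-1) (-1)) = 1 := fun R =>
    (finrank_V₁ (-1, -1)).trans (by decide)
  have d3 : ∀ R : PeriodPair, Module.finrank ℂ (V₁ R (-1) 1) = 1 := fun R =>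
    (finrank_V₁ (-1, 1)).trans (by decide)
  have e1 : Module.finrank ℂ (eigenspace (rep44 P Q) 1 1) = 5 :=
    (finrank_eigenspace44 (1, 1)).trans (by decide)
  have e2 : Module.finrank ℂ (eigenspace (rep44 P Q) (-1) (-1)) = 5 :=
    (finrank_eigenspace44 (-1, -1)).trans (by decide)
  have m0 := fun R : PeriodPair => eigenbasis_mem (P := R) 0
  have m1 := fun R : PeriodPair => eigenbasis_mem (P := R) 1
  have m2 := fun R : PeriodPair => eigenbasis_mem (P := R) 2
  have m3 := fun R : PeriodPair => eigenbasis_mem (P := R) 3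
  rw [V₂_eq (Q := Q) 1 1, V₂_eq (Q := Q) (-1) (-1), V₂_eq (Q := Q) 1 (-1)]
  -- `V₁⁺⁺` has basis the vectors `0`, `1`, and `V₁⁻⁻`, `V₁⁻⁺` are spanned by the vectors `2`, `3`
  have r1 : LinearMap.range
      ((kunnethOn (V₁ P 1 1) (V₁ Q 1 1)).coprod (kunnethOn (V₁ P (-1) (-1)) (V₁ Q (-1) (-1))))
      = eigenspace (rep44 P Q) 1 1 := by
    rw [LinearMap.range_coprod]
    refine le_antisymm (sup_le ?_ ?_) ?_
    · exact V₂_eq (Q := Q) 1 1 ▸ range_kunnethOn_le (P := P) (Q := Q) (ε₁ := 1) (ε₂ := 1)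
    · exact V₂_eq (Q := Q) (-1) (-1) ▸
        range_kunnethOn_le (P := P) (Q := Q) (ε₁ := -1) (ε₂ := -1) (δ₁ := -1) (δ₂ := -1)
    · rw [eigenspace_eq_span (rep44 P Q) (eigenbasis44 P Q) eigensign44 eigenbasis44_mem (1, 1),
        Submodule.span_le]
      rintro _ ⟨⟨i, j⟩, hij, rfl⟩
      have hcases : (i = 0 ∨ i = 1) ∧ (j = 0 ∨ j = 1) ∨ i = 2 ∧ j = 2 := by
        revert i j
        decide
      rcases hcases with ⟨hi, hj⟩ | ⟨rfl, rfl⟩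
      · refine Submodule.mem_sup_left (mem_range_kunnethOn ?_ ?_)
        · rcases hi with rfl | rfl
          exacts [m0 P, m1 P]
        · rcases hj with rfl | rfl
          exacts [m0 Q, m1 Q]
      · exact Submodule.mem_sup_right (mem_range_kunnethOn (m2 P) (m2 Q))
  have r2 : LinearMap.range ((kunnethOn (V₁ P 1 1) (V₁ Q (-1) (-1))).coprod
      ((kunnethOn (V₁ P (-1) (-1)) (V₁ Q 1 1)).coprod (kunnethOn (V₁ P (-1) 1) (V₁ Q (-1) 1))))
      = eigenspace (rep44 P Q) (-1) (-1) := by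
    rw [LinearMap.range_coprod, LinearMap.range_coprod]
    refine le_antisymm (sup_le ?_ (sup_le ?_ ?_)) ?_
    · exact V₂_eq (Q := Q) (-1) (-1) ▸
        range_kunnethOn_le (P := P) (Q := Q) (ε₁ := 1) (ε₂ := 1) (δ₁ := -1) (δ₂ := -1)
    · exact V₂_eq (Q := Q) 1 1 ▸
        range_kunnethOn_le (P := P) (Q := Q) (ε₁ := -1) (ε₂ := -1) (δ₁ := 1) (δ₂ := 1)
    · exact V₂_eq (Q := Q) 1 (-1) ▸
        range_kunnethOn_le (P := P) (Q := Q) (ε₁ := -1) (ε₂ := 1) (δ₁ := 1) (δ₂ := -1)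
    · rw [eigenspace_eq_span (rep44 P Q) (eigenbasis44 P Q) eigensign44 eigenbasis44_mem (-1, -1),
        Submodule.span_le]
      rintro _ ⟨⟨i, j⟩, hij, rfl⟩
      have hcases : (i = 0 ∨ i = 1) ∧ j = 2 ∨ i = 2 ∧ (j = 0 ∨ j = 1) ∨ i = 3 ∧ j = 3 := by
        revert i j
        decide
      rcases hcases with ⟨hi, rfl⟩ | ⟨rfl, hj⟩ | ⟨rfl, rfl⟩
      · refine Submodule.mem_sup_left (mem_range_kunnethOn ?_ (m2 Q))
        rcases hi with rfl | rfl
        exacts [m0 P, m1 P]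
      · refine Submodule.mem_sup_right (Submodule.mem_sup_left (mem_range_kunnethOn (m2 P) ?_))
        rcases hj with rfl | rfl
        exacts [m0 Q, m1 Q]
      · exact Submodule.mem_sup_right (Submodule.mem_sup_right
          (mem_range_kunnethOn (m3 P) (m3 Q)))
  refine ⟨invariants_eq_eigenspace _, ⟨?_, r1, nonempty_equiv_of_finrank e1⟩,
    ?_, r2, nonempty_equiv_of_finrank e2⟩
  -- the domain and the range both have dimension `5`
  · refine injective_of_finrank_range_two _ ?_
    rw [r1, e1, d1, d1, d2, d2]
  · refine injective_of_finrank_range_three _ ?_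
    rw [r2, e2, d1, d1, d2, d2, d3, d3]
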